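/- **Theorem (Smoothness of the strong metric).** Let $d\ge 0$ be an integer and let $s>1+\frac d2$ be real. Let $H^s=H^s(\mathbb R^d,\mathbb R^d)$ be the space of all $f\in L^2=L^2(\mathbb R^d,\mathbb R^d)$ with $\|f\|_{H^s}:=\|(1+|\xi|^2)^{s/2}\hat f\|_{L^2}<\infty$, let $H^{-s}$ be the topological dual of $H^s$, and let $$\mathcal D^s(\mathbb R^d)=\{\varphi:\mathbb R^d\to\mathbb R^d \text{ an orientation-preserving } C^1\text{-diffeomorphism with } \varphi-\mathrm{id}\in H^s\},$$ a smooth Hilbert manifold with the single global chart $\varphi\mapsto\varphi-\mathrm{id}$ onto an open subset of $H^s$; in particular $T_\varphi\mathcal D^s(\mathbb R^d)=H^s$. For $\varphi\in\mathcal D^s(\mathbb R^d)$ write $J_\varphi=\det(d\varphi)$, $R_\varphi u=u\circ\varphi$, and $M_{J_\varphi}$ for pointwise multiplication by $J_\varphi$ on $L^2$. Let $B:H^s\to L^2$ be a topological linear isomorphism such that the operators $B_\varphi:=R_\varphi\circ B\circ R_{\varphi^{-1}}$ are bounded from $H^s$ to $L^2$ and the map $$\mathcal D^s(\mathbb R^d)\to\mathcal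 L(H^s,L^2),\qquad \varphi\mapsto B_\varphi,$$ is smooth ($C^\infty$). Let $A:=B^*B:H^s\to H^{-s}$, where $B^*:L^2\to H^{-s}$ is the transpose, $(B^*u)(v)=\langle u,Bv\rangle_{L^2}$. Then $A$ induces a smooth and strong Riemannian metric on $\mathcal D^s(\mathbb R^d)$. That is, for all $\varphi\in\mathcal D^s(\mathbb R^d)$ and $v\in H^s$ one has $v\circ\varphi^{-1}\in H^s$; the formula $$G_\varphi(v_1,v_2)=\bigl(A(v_1\circ\varphi^{-1}),\,v_2\circ\varphi^{-1}\bigr)_{H^{-s}\times H^s}$$ defines for each $\varphi$ a bounded, symmetric, positive definite bilinear form on $H^s$; the map $\varphi\mapsto G_\varphi$ is smooth from $\mathcal D^s(\mathbb R^d)$ to the bounded bilinear forms on $H^s$ (with the operator norm); and for every $\varphi$ the flat map $\tilde G_\varphi:H^s\to H^{-s}$, $v\mapsto G_\varphi(v,\cdot)$, is a topological linear isomorphism. Moreover, $M_{J_\varphi}$ is a bounded operator on $L^2$ and $$\tilde G_\varphi=B_\varphi^{*}\circ M_{J_\varphi}\circ B_\varphi .$$ -/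

import Mathlib

open MeasureTheory Filter Topology
open scoped FourierTransform Manifold ContDiff RealInnerProductSpace

noncomputable section
namespace SobolevDiff

/-- The Euclidean space `ℝ^d`. -/
abbrev E (d : ℕ) : Type := EuclideanSpace ℝ (Fin d)

/-- The Hermitian space `ℂ^d`. -/
abbrev EC (d : ℕ) : Type := EuclideanSpace ℂ (Fin d)

/-- The real Hilbert space `L²(ℝ^d, ℝ^d)`. -/
abbrev L2 (d : ℕ) : Type := Lp (E d) 2 (volume : Measure (E d))

/-- The Hilbert space `L²(ℝ^d, ℂ^d)`. -/
abbrev L2C (d : ℕ) : Type := Lp (EC d) 2 (volume : Measure (E d))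

/-- The inclusion `ℝ^d → ℂ^d`. -/
def complexify (d : ℕ) : E d →L[ℝ] EC d :=
  LinearMap.toContinuousLinearMap
    { toFun := fun x => WithLp.toLp 2 (fun i => (x i : ℂ))
      map_add' := fun x y => by ext i; simp
      map_smul' := fun c x => by ext i; simp }

/-- The real part `ℂ^d → ℝ^d`. -/
def realPart (d : ℕ) : EC d →L[ℝ] E d :=
  LinearMap.toContinuousLinearMap
    { toFun := fun x => WithLp.toLp 2 (fun i => (x i).re)
      map_add' := fun x y => by ext i; simp
      map_smul' := fun c x => by ext i; simp }

theorem realPart_complexify (d : ℕ) (x : E d) : realPart d (complexify d x) = x := by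
  ext i; simp [realPart, complexify]

/-- The Fourier transform `f̂(ξ) = ∫ exp(-2πi⟨x,ξ⟩) f(x) dx` of an `L²` vector field. -/
def fourierL2 (d : ℕ) : L2 d →ₗ[ℝ] L2C d where
  toFun f := 𝓕 ((complexify d).compLpL 2 volume f)
  map_add' f g := by rw [map_add, FourierTransform.fourier_add]
  map_smul' c f := by
    have h : ∀ u : L2C d, 𝓕 (c • u) = c • 𝓕 u := by
      intro u
      have h1 : ∀ w : L2C d, c • w = (c : ℂ) • w := by
        intro w
        apply Lp.ext
        filter_upwards [Lp.coeFn_smul c w, Lp.coeFn_smul (c : ℂ) w] with x h2 h3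
        rw [h2, h3]
        ext i
        simp
      rw [h1, h1, FourierTransform.fourier_smul]
    rw [map_smul, h, RingHom.id_apply]

/-- The weight `(1 + |ξ|²)^{s/2}`. -/
def weight (d : ℕ) (s : ℝ) (ξ : E d) : ℝ := (1 + ‖ξ‖ ^ 2) ^ (s / 2)

theorem weight_pos (d : ℕ) (s : ℝ) (ξ : E d) : 0 < weight d s ξ := by
  unfold weight; positivity

/-- The fields `f ∈ L²(ℝ^d, ℝ^d)` for which `(1 + |ξ|²)^{s/2} f̂` is square integrable. -/
def sobolevSubmodule (d : ℕ) (s : ℝ) : Submodule ℝ (L2 d) where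
  carrier := {f | MemLp (fun ξ => weight d s ξ • fourierL2 d f ξ) 2 (volume : Measure (E d))}
  zero_mem' := by
    refine (MemLp.zero (ε := EC d)).ae_eq ?_
    rw [map_zero]
    filter_upwards [Lp.coeFn_zero (EC d) 2 (volume : Measure (E d))] with ξ h
    simp
  add_mem' := by
    intro f g hf hg
    refine (MemLp.add hf hg).ae_eq ?_
    rw [map_add]
    filter_upwards [Lp.coeFn_add (fourierL2 d f) (fourierL2 d g)] with ξ h
    simp only [h, Pi.add_apply, smul_add]
  smul_mem' := by
    intro c f hf
    refine (MemLp.const_smul hf c).ae_eq ?_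
    rw [map_smul]
    filter_upwards [Lp.coeFn_smul c (fourierL2 d f)] with ξ h
    simp only [h, Pi.smul_apply]
    rw [smul_comm]

/-- The Sobolev space `H^s(ℝ^d, ℝ^d)`. -/
def H (d : ℕ) (s : ℝ) : Type := ↥(sobolevSubmodule d s)

instance (d : ℕ) (s : ℝ) : AddCommGroup (H d s) :=
  inferInstanceAs (AddCommGroup ↥(sobolevSubmodule d s))

instance (d : ℕ) (s : ℝ) : Module ℝ (H d s) :=
  inferInstanceAs (Module ℝ ↥(sobolevSubmodule d s))

/-- A Sobolev field, seen in `L²`. -/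
def H.toL2 {d : ℕ} {s : ℝ} : H d s →ₗ[ℝ] L2 d := (sobolevSubmodule d s).subtype

instance (d : ℕ) (s : ℝ) : CoeFun (H d s) (fun _ => E d → E d) := ⟨fun f => H.toL2 f⟩

/-- The linear map `f ↦ (1 + |ξ|²)^{s/2} f̂`, from `H^s` to `L²`. -/
def besselMap (d : ℕ) (s : ℝ) : H d s →ₗ[ℝ] L2C d where
  toFun f := MemLp.toLp (fun ξ => weight d s ξ • fourierL2 d f.toL2 ξ) f.2
  map_add' f g := by
    refine (MemLp.toLp_congr _ (f.2.add g.2) ?_).trans (MemLp.toLp_add f.2 g.2)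
    rw [map_add, map_add]
    filter_upwards [Lp.coeFn_add (fourierL2 d f.toL2) (fourierL2 d g.toL2)] with ξ h
    simp only [h, Pi.add_apply, smul_add]
    rfl
  map_smul' c f := by
    refine (MemLp.toLp_congr _ (f.2.const_smul c) ?_).trans (MemLp.toLp_const_smul c f.2)
    rw [map_smul, map_smul]
    filter_upwards [Lp.coeFn_smul c (fourierL2 d f.toL2)] with ξ h
    simp only [h, Pi.smul_apply]
    rw [smul_comm]
    rfl

theorem besselMap_coe (d : ℕ) (s : ℝ) (f : H d s) :
    besselMap d s f =ᵐ[volume] fun ξ => weight d s ξ • fourierL2 d f.toL2 ξ :=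
  MemLp.coeFn_toLp f.2

theorem fourierL2_injective (d : ℕ) : Function.Injective (fourierL2 d) := by
  intro f g h
  have h1 : (complexify d).compLpL 2 volume f = (complexify d).compLpL 2 volume g :=
    (Lp.fourierTransformₗᵢ (E d) (EC d)).injective h
  apply Lp.ext
  filter_upwards [(complexify d).coeFn_compLpL f, (complexify d).coeFn_compLpL g] with x hf hg
  rw [← realPart_complexify d (f x), ← realPart_complexify d (g x), ← hf, ← hg, h1]

theorem besselMap_injective (d : ℕ) (s : ℝ) : Function.Injective (besselMap d s) := by
  intro f g h
  apply Subtype.ext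
  apply fourierL2_injective
  apply Lp.ext
  have hf := besselMap_coe d s f
  have hg := besselMap_coe d s g
  rw [h] at hf
  filter_upwards [hf, hg] with ξ h1 h2
  exact smul_right_injective _ (weight_pos d s ξ).ne' (h1.symm.trans h2)

/-- The norm `‖f‖_{H^s} = ‖(1 + |ξ|²)^{s/2} f̂‖_{L²}`. -/
instance (d : ℕ) (s : ℝ) : NormedAddCommGroup (H d s) :=
  NormedAddCommGroup.induced (H d s) (L2C d) (besselMap d s) (besselMap_injective d s)

instance (d : ℕ) (s : ℝ) : NormedSpace ℝ (H d s) :=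
  NormedSpace.induced ℝ (H d s) (L2C d) (besselMap d s)

/-- An integrable function that is also in `L²` has the same Fourier inverse in both senses. -/
theorem fourierInv_ae_eq (d : ℕ) (h : L2C d) (hh : Integrable h volume) :
    ((𝓕⁻ h : L2C d) : E d → EC d) =ᵐ[volume] 𝓕⁻ (h : E d → EC d) := by
  have hL : Continuous fun p : E d × E d => (-innerₗ (E d)) p.1 p.2 :=
    (continuous_inner (𝕜 := ℝ) (E := E d)).neg
  have hc : Continuous (𝓕⁻ (h : E d → EC d)) :=
    VectorFourier.fourierIntegral_continuous Real.continuous_fourierChar hL hh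
  refine ae_eq_of_integral_contDiff_smul_eq
    ((Lp.memLp (𝓕⁻ h : L2C d)).locallyIntegrable (by norm_num)) hc.locallyIntegrable ?_
  intro g hg hgc
  have hgc' : HasCompactSupport (fun x => (g x : ℂ)) := hgc.comp_left (g := ((↑) : ℝ → ℂ)) (by simp)
  have hg' : ContDiff ℝ ∞ (fun x => (g x : ℂ)) := Complex.ofRealCLM.contDiff.comp hg
  set G : SchwartzMap (E d) ℂ := hgc'.toSchwartzMap hg' with hG
  have hGx : ∀ x, G x = (g x : ℂ) := fun x => rfl
  have h1 : ∫ x, G x • (𝓕⁻ h : L2C d) x = ∫ x, (𝓕⁻ G) x • h x := by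
    rw [← Lp.toTemperedDistribution_apply, ← Lp.fourierInv_toTemperedDistribution_eq,
      TemperedDistribution.fourierInv_apply, Lp.toTemperedDistribution_apply]
  have h2 : ∫ x, (𝓕⁻ G) x • h x = ∫ x, G x • (𝓕⁻ (h : E d → EC d)) x := by
    rw [SchwartzMap.fourierInv_coe]
    have h3 := VectorFourier.integral_fourierIntegral_smul_eq_flip (μ := (volume : Measure (E d)))
      (ν := (volume : Measure (E d))) Real.continuous_fourierChar hL
      (G.integrable (μ := volume)) hh
    have h4 : (-innerₗ (E d)).flip = -innerₗ (E d) := by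
      ext x y; simp [real_inner_comm]
    rw [h4] at h3
    exact h3
  have h5 := h1.trans h2
  simpa only [hGx, Complex.coe_smul] using h5

theorem memLp_weight (d : ℕ) (s : ℝ) (hs : 1 + (d : ℝ) / 2 < s) :
    MemLp (fun ξ => (1 + ‖ξ‖) * (weight d s ξ)⁻¹) 2 (volume : Measure (E d)) := by
  have hcont : Continuous (fun ξ : E d => (1 + ‖ξ‖) * (weight d s ξ)⁻¹) := by
    refine (by fun_prop : Continuous fun ξ : E d => (1 + ‖ξ‖)).mul (Continuous.inv₀ ?_ ?_)
    · unfold weight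
      exact Continuous.rpow_const (by fun_prop) (fun ξ => Or.inl (by positivity))
    · exact fun ξ => (weight_pos d s ξ).ne'
  rw [memLp_two_iff_integrable_sq hcont.aestronglyMeasurable]
  have hint : Integrable (fun ξ : E d => (1 + ‖ξ‖ ^ 2) ^ (-(2 * (s - 1)) / 2)) volume :=
    integrable_rpow_neg_one_add_norm_sq (by simp; linarith)
  refine (hint.const_mul 2).mono' (hcont.pow 2).aestronglyMeasurable (ae_of_all _ fun ξ => ?_)
  have hp : 0 < 1 + ‖ξ‖ ^ 2 := by positivity
  rw [Real.norm_of_nonneg (by positivity), mul_pow, inv_pow]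
  have e1 : weight d s ξ ^ 2 = (1 + ‖ξ‖ ^ 2) ^ s := by
    unfold weight
    rw [← Real.rpow_natCast, ← Real.rpow_mul hp.le]
    norm_num
  have e2 : (1 + ‖ξ‖ ^ 2) ^ (-(2 * (s - 1)) / 2) = (1 + ‖ξ‖ ^ 2) * ((1 + ‖ξ‖ ^ 2) ^ s)⁻¹ := by
    rw [show -(2 * (s - 1)) / 2 = 1 + -s by ring, Real.rpow_add hp, Real.rpow_one,
      Real.rpow_neg hp.le]
  rw [e1, e2, ← mul_assoc]
  gcongr
  nlinarith [sq_nonneg (1 - ‖ξ‖)]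

/-- The Sobolev embedding of `H^s` in `C¹`, for `s > 1 + d/2`. -/
theorem exists_c1_rep (d : ℕ) (s : ℝ) (hs : 1 + (d : ℝ) / 2 < s) :
    ∃ C : ℝ, 0 ≤ C ∧ ∀ f : H d s, ∃ g : E d → E d, ContDiff ℝ 1 g ∧ (f =ᵐ[volume] g) ∧
      (∀ x, ‖fderiv ℝ g x‖ ≤ C * ‖f‖) ∧ Tendsto (fderiv ℝ g) (cocompact (E d)) (𝓝 0) := by
  have hw := memLp_weight d s hs
  set K : ℝ := (eLpNorm (fun ξ => (1 + ‖ξ‖) * (weight d s ξ)⁻¹) 2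
    (volume : Measure (E d))).toReal with hK
  refine ⟨‖realPart d‖ * (2 * Real.pi * K), by positivity, fun f => ?_⟩
  set h : L2C d := fourierL2 d f.toL2 with hh
  set u : L2C d := besselMap d s f with hu
  have hnorm : ‖f‖ = ‖u‖ := rfl
  -- the weighted bound
  have hub : ∀ᵐ ξ ∂(volume : Measure (E d)),
      (1 + ‖ξ‖) * ‖h ξ‖ = ((1 + ‖ξ‖) * (weight d s ξ)⁻¹) * ‖u ξ‖ := by
    filter_upwards [besselMap_coe d s f] with ξ hξ
    rw [← hu] at hξ
    rw [hξ, norm_smul, Real.norm_of_nonneg (weight_pos d s ξ).le]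
    have := (weight_pos d s ξ).ne'
    field_simp
    rfl
  have hmul : Integrable (fun ξ => ((1 + ‖ξ‖) * (weight d s ξ)⁻¹) * ‖u ξ‖)
      (volume : Measure (E d)) := MemLp.integrable_mul hw (Lp.memLp u).norm
  have hI1 : Integrable (fun ξ => (1 + ‖ξ‖) * ‖h ξ‖) (volume : Measure (E d)) :=
    hmul.congr (hub.mono fun ξ hξ => hξ.symm)
  have hIh : Integrable h (volume : Measure (E d)) := by
    refine hI1.mono' (Lp.aestronglyMeasurable h) (ae_of_all _ fun ξ => ?_)
    nlinarith [norm_nonneg ξ, norm_nonneg (h ξ), mul_nonneg (norm_nonneg ξ) (norm_nonneg (h ξ))]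
  have hIh' : Integrable (fun ξ => ‖ξ‖ * ‖h ξ‖) (volume : Measure (E d)) := by
    refine hI1.mono' (continuous_norm.aestronglyMeasurable.mul
      (Lp.aestronglyMeasurable h).norm) (ae_of_all _ fun ξ => ?_)
    rw [Real.norm_of_nonneg (by positivity)]
    nlinarith [norm_nonneg ξ, norm_nonneg (h ξ)]
  have hbound : ∫ ξ, ‖ξ‖ * ‖h ξ‖ ≤ K * ‖f‖ := by
    have hun : MemLp (fun ξ => ‖u ξ‖) 2 (volume : Measure (E d)) := (Lp.memLp u).norm
    calc ∫ ξ, ‖ξ‖ * ‖h ξ‖ ≤ ∫ ξ, (1 + ‖ξ‖) * ‖h ξ‖ := by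
          refine integral_mono hIh' hI1 fun ξ => ?_
          simp only
          gcongr
          linarith
      _ = ∫ ξ, ((1 + ‖ξ‖) * (weight d s ξ)⁻¹) * ‖u ξ‖ := integral_congr_ae hub
      _ = ⟪hw.toLp, hun.toLp⟫ := by
          rw [L2.inner_def]
          refine integral_congr_ae ?_
          filter_upwards [hw.coeFn_toLp, hun.coeFn_toLp] with ξ h1 h2
          rw [h1, h2]
          simp [mul_comm]
      _ ≤ ‖hw.toLp‖ * ‖hun.toLp‖ := real_inner_le_norm _ _
      _ = K * ‖f‖ := by
          rw [Lp.norm_toLp, Lp.norm_toLp, eLpNorm_norm, hnorm, Lp.norm_def]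
  set D : E d → (E d →L[ℝ] EC d) := VectorFourier.fourierSMulRight (innerSL ℝ) h with hD
  have hDn : ∀ ξ, ‖D ξ‖ ≤ 2 * Real.pi * (‖ξ‖ * ‖h ξ‖) := by
    intro ξ
    rw [hD, VectorFourier.norm_fourierSMulRight, innerSL_apply_norm, mul_assoc]
  have hDm : AEStronglyMeasurable D volume :=
    AEStronglyMeasurable.fourierSMulRight (Lp.aestronglyMeasurable h)
  have hDI : Integrable D volume :=
    (hIh'.const_mul (2 * Real.pi)).mono' hDm (ae_of_all _ hDn)
  have hder : ∀ x, HasFDerivAt (𝓕 (h : E d → EC d)) (𝓕 D x) x :=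
    fun x => Real.hasFDerivAt_fourier hIh hIh' x
  have hDc : Continuous (𝓕 D) :=
    VectorFourier.fourierIntegral_continuous Real.continuous_fourierChar
      (continuous_inner (𝕜 := ℝ) (E := E d)) hDI
  have hD0 : Tendsto (𝓕 D) (cocompact (E d)) (𝓝 0) :=
    tendsto_integral_exp_inner_smul_cocompact D
  have hDb : ∀ x, ‖𝓕 D x‖ ≤ 2 * Real.pi * (K * ‖f‖) := by
    intro x
    calc ‖𝓕 D x‖ ≤ ∫ ξ, ‖D ξ‖ := VectorFourier.norm_fourierIntegral_le_integral_norm _ _ _ _ _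
      _ ≤ ∫ ξ, 2 * Real.pi * (‖ξ‖ * ‖h ξ‖) :=
        integral_mono hDI.norm (hIh'.const_mul _) hDn
      _ = 2 * Real.pi * ∫ ξ, ‖ξ‖ * ‖h ξ‖ := integral_const_mul _ _
      _ ≤ _ := by gcongr
  set g : E d → E d := fun x => realPart d (𝓕 (h : E d → EC d) (-x)) with hg
  have hgd : ∀ x, HasFDerivAt g (-((realPart d).comp (𝓕 D (-x)))) x := by
    intro x
    have h1 := ((realPart d).hasFDerivAt.comp (-x) (hder (-x))).comp x (hasFDerivAt_id x).neg
    convert! h1 using 1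
    ext v
    simp
  have hfd : fderiv ℝ g = fun x => -((realPart d).comp (𝓕 D (-x))) :=
    funext fun x => (hgd x).fderiv
  have hcomp : Continuous fun T : E d →L[ℝ] EC d => -((realPart d).comp T) := by fun_prop
  refine ⟨g, ?_, ?_, ?_, ?_⟩
  · rw [contDiff_one_iff_fderiv]
    refine ⟨fun x => (hgd x).differentiableAt, ?_⟩
    rw [hfd]
    exact hcomp.comp (hDc.comp continuous_neg)
  · have h1 : (𝓕⁻ h : L2C d) = (complexify d).compLpL 2 volume f.toL2 :=
      (Lp.fourierTransformₗᵢ (E d) (EC d)).symm_apply_apply _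
    filter_upwards [fourierInv_ae_eq d h hIh, (complexify d).coeFn_compLpL f.toL2] with x h2 h3
    rw [h1, h3, Real.fourierInv_eq_fourier_neg] at h2
    rw [hg]
    simp only
    rw [← h2, realPart_complexify]
  · intro x
    rw [hfd]
    simp only [norm_neg]
    calc ‖(realPart d).comp (𝓕 D (-x))‖ ≤ ‖realPart d‖ * ‖𝓕 D (-x)‖ :=
          ContinuousLinearMap.opNorm_comp_le _ _
      _ ≤ ‖realPart d‖ * (2 * Real.pi * (K * ‖f‖)) := by gcongr; exact hDb _
      _ = _ := by ring
  · rw [hfd]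
    have h1 := (hcomp.tendsto 0).comp (hD0.comp
      (Homeomorph.neg (E d)).isClosedEmbedding.tendsto_cocompact)
    simp only [ContinuousLinearMap.comp_zero, neg_zero] at h1
    exact h1

theorem det_pos_of_norm_lt {d : ℕ} (T : E d →L[ℝ] E d) (hT : ‖T‖ < 1) :
    0 < (ContinuousLinearMap.id ℝ (E d) + T).det := by
  have hne : ∀ t ∈ Set.Icc (0 : ℝ) 1, (ContinuousLinearMap.id ℝ (E d) + t • T).det ≠ 0 := by
    intro t ht
    have h1 : ‖-(t • T)‖ < 1 := by
      rw [norm_neg, norm_smul, Real.norm_of_nonneg ht.1]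
      calc t * ‖T‖ ≤ 1 * ‖T‖ := by gcongr; exact ht.2
        _ < 1 := by simpa
    have h2 := (Units.oneSub (-(t • T)) h1).isUnit
    have h3 : ((Units.oneSub (-(t • T)) h1 : (E d →L[ℝ] E d)ˣ) : E d →L[ℝ] E d)
        = ContinuousLinearMap.id ℝ (E d) + t • T := by simp; rfl
    rw [h3] at h2
    obtain ⟨v, hv⟩ := h2
    have h5 := congrArg ContinuousLinearMap.det v.mul_inv
    intro h0
    rw [hv] at h5
    simp only [ContinuousLinearMap.det, ContinuousLinearMap.toLinearMap_mul, map_mul] at h5 h0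
    rw [h0, zero_mul] at h5
    simp at h5
  have hc : ContinuousOn (fun t : ℝ => (ContinuousLinearMap.id ℝ (E d) + t • T).det)
      (Set.Icc 0 1) := by
    apply Continuous.continuousOn
    exact ContinuousLinearMap.continuous_det.comp (by fun_prop)
  by_contra hneg
  have h0 : (ContinuousLinearMap.id ℝ (E d) + (0 : ℝ) • T).det = 1 := by
    simp [ContinuousLinearMap.det]
  have h1 : (ContinuousLinearMap.id ℝ (E d) + (1 : ℝ) • T).det ≤ 0 := by
    rw [one_smul]; exact not_lt.1 hneg
  obtain ⟨t, ht, ht0⟩ := intermediate_value_Icc' zero_le_one hc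
    (show (0 : ℝ) ∈ Set.Icc _ _ from ⟨h1, by rw [h0]; exact zero_le_one⟩)
  exact hne t ht ht0

/-- The group `D^s(ℝ^d)` of orientation-preserving `C¹`-diffeomorphisms `φ` of `ℝ^d` such that
`φ - id` belongs to `H^s(ℝ^d, ℝ^d)`. The field `disp` is the class of `φ - id`; it is determined
by `φ`, and determines it. -/
structure DiffGroup (d : ℕ) (s : ℝ) (hs : 1 + (d : ℝ) / 2 < s) where
  toEquiv : E d ≃ E d
  contDiff_toFun : ContDiff ℝ 1 toEquiv
  contDiff_symm : ContDiff ℝ 1 toEquiv.symm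
  det_pos : ∀ x, 0 < (fderiv ℝ toEquiv x).det
  disp : H d s
  disp_ae : disp =ᵐ[volume] fun x => toEquiv x - x

namespace DiffGroup
variable {d : ℕ} {s : ℝ} {hs : 1 + (d : ℝ) / 2 < s}

theorem disp_injective : Function.Injective (disp : DiffGroup d s hs → H d s) := by
  intro φ ψ h
  have h1 : (fun x => φ.toEquiv x - x) =ᵐ[volume] fun x => ψ.toEquiv x - x :=
    φ.disp_ae.symm.trans (h ▸ ψ.disp_ae)
  have h2 := (Continuous.ae_eq_iff_eq volume
    (φ.contDiff_toFun.continuous.sub continuous_id)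
    (ψ.contDiff_toFun.continuous.sub continuous_id)).1 h1
  have h3 : φ.toEquiv = ψ.toEquiv := by
    ext1 x
    simpa using congrFun h2 x
  cases φ; cases ψ
  simp_all

/-- The topology for which `φ ↦ φ - id ∈ H^s` is a homeomorphism onto its image. -/
instance : TopologicalSpace (DiffGroup d s hs) := TopologicalSpace.induced disp inferInstance

/-- The derivative of the inverse of a diffeomorphism in the group is bounded. -/
theorem exists_fderiv_symm_bound (φ : DiffGroup d s hs) :
    ∃ K : ℝ, 0 ≤ K ∧ ∀ y, ‖fderiv ℝ φ.toEquiv.symm y‖ ≤ K := by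
  obtain ⟨C, hC, hrep⟩ := exists_c1_rep d s hs
  obtain ⟨g, hg, hfg, -, hg0⟩ := hrep φ.disp
  have heq : (fun x => φ.toEquiv x - x) = g :=
    (Continuous.ae_eq_iff_eq volume (φ.contDiff_toFun.continuous.sub continuous_id)
      hg.continuous).1 (φ.disp_ae.symm.trans hfg)
  have hφd : ∀ x, HasFDerivAt φ.toEquiv (ContinuousLinearMap.id ℝ (E d) + fderiv ℝ g x) x := by
    intro x
    have h1 := (hasFDerivAt_id (𝕜 := ℝ) x).add
      (hg.differentiable (by norm_num) x).hasFDerivAt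
    refine h1.congr_of_eventuallyEq (Eventually.of_forall fun z => ?_)
    rw [← heq]
    simp
  have hinv : ∀ x, (fderiv ℝ φ.toEquiv.symm (φ.toEquiv x)).comp
      (ContinuousLinearMap.id ℝ (E d) + fderiv ℝ g x) = ContinuousLinearMap.id ℝ (E d) := by
    intro x
    have h1 := (φ.contDiff_symm.differentiable (by norm_num) (φ.toEquiv x)).hasFDerivAt.comp x
      (hφd x)
    have h2 : (φ.toEquiv.symm ∘ φ.toEquiv : E d → E d) = id := by ext1 x; simp
    rw [h2] at h1
    exact h1.unique (hasFDerivAt_id x)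
  set F : E d → (E d →L[ℝ] E d) := fun x => fderiv ℝ φ.toEquiv.symm (φ.toEquiv x) with hF
  have hFc : Continuous F :=
    (φ.contDiff_symm.continuous_fderiv (by norm_num)).comp φ.contDiff_toFun.continuous
  have hev : ∀ᶠ x in cocompact (E d), ‖fderiv ℝ g x‖ < 1 / 2 := by
    have := (tendsto_zero_iff_norm_tendsto_zero.1 hg0).eventually_lt_const
      (show (0 : ℝ) < 1 / 2 by norm_num)
    exact this
  obtain ⟨t, ht, hts⟩ := mem_cocompact.1 hev
  obtain ⟨K, hK⟩ := ht.exists_bound_of_continuousOn hFc.continuousOn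
  refine ⟨max K 2, by positivity, fun y => ?_⟩
  obtain ⟨x, rfl⟩ := φ.toEquiv.surjective y
  change ‖F x‖ ≤ _
  by_cases hx : x ∈ t
  · exact (hK x hx).trans (le_max_left _ _)
  · refine le_trans ?_ (le_max_right _ _)
    have h1 : ‖fderiv ℝ g x‖ < 1 / 2 := hts hx
    have h2 : F x = ContinuousLinearMap.id ℝ (E d) - (F x).comp (fderiv ℝ g x) := by
      rw [← hinv x, ContinuousLinearMap.comp_add, ContinuousLinearMap.comp_id, hF]
      simp
    have h3 : ‖F x‖ ≤ 1 + ‖F x‖ * ‖fderiv ℝ g x‖ := by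
      calc ‖F x‖ = ‖ContinuousLinearMap.id ℝ (E d) - (F x).comp (fderiv ℝ g x)‖ := by rw [← h2]
        _ ≤ ‖ContinuousLinearMap.id ℝ (E d)‖ + ‖(F x).comp (fderiv ℝ g x)‖ := norm_sub_le _ _
        _ ≤ _ := add_le_add ContinuousLinearMap.norm_id_le (ContinuousLinearMap.opNorm_comp_le _ _)
    nlinarith [norm_nonneg (F x)]

theorem isOpen_range_disp : IsOpen (Set.range (disp : DiffGroup d s hs → H d s)) := by
  obtain ⟨C, hC, hrep⟩ := exists_c1_rep d s hs
  rw [Metric.isOpen_iff]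
  rintro _ ⟨φ, rfl⟩
  obtain ⟨K, hK, hbd⟩ := exists_fderiv_symm_bound φ
  have hq : 0 < C * (K + 1) + 1 := by positivity
  refine ⟨(C * (K + 1) + 1)⁻¹ , by positivity, ?_⟩
  intro f hf
  obtain ⟨g, hg, hfg, hgb, -⟩ := hrep (f - φ.disp)
  rw [Metric.mem_ball, dist_eq_norm] at hf
  -- the perturbed map is `θ ∘ φ`, with `θ = id + g ∘ φ⁻¹` close to the identity in `C¹`
  set T : E d → (E d →L[ℝ] E d) :=
    fun y => (fderiv ℝ g (φ.toEquiv.symm y)).comp (fderiv ℝ φ.toEquiv.symm y) with hT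
  have hsmall : C * ‖f - φ.disp‖ * K < 1 := by
    have h1 : ‖f - φ.disp‖ * (C * (K + 1) + 1) < 1 := by
      rwa [inv_eq_one_div, lt_div_iff₀ hq] at hf
    nlinarith [mul_nonneg (norm_nonneg (f - φ.disp)) hC, norm_nonneg (f - φ.disp)]
  set c : NNReal := ⟨C * ‖f - φ.disp‖ * K, by positivity⟩ with hc
  have hTb : ∀ y, ‖T y‖ ≤ C * ‖f - φ.disp‖ * K := fun y =>
    (ContinuousLinearMap.opNorm_comp_le _ _).trans
      (mul_le_mul (hgb _) (hbd y) (norm_nonneg _) (by positivity))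
  set k : E d → E d := fun y => g (φ.toEquiv.symm y) with hk
  have hkd : ∀ y, HasFDerivAt k (T y) y := fun y =>
    (hg.differentiable (by norm_num) _).hasFDerivAt.comp y
      (φ.contDiff_symm.differentiable (by norm_num) y).hasFDerivAt
  have hkc : ContDiff ℝ 1 k := hg.comp φ.contDiff_symm
  have hklip : LipschitzWith c k := lipschitzWith_of_nnnorm_fderiv_le
    (fun y => (hkd y).differentiableAt) (fun y => by rw [(hkd y).fderiv]; exact hTb y)
  set θ : E d → E d := fun y => y + k y with hθ
  have happ : ApproximatesLinearOn θ
      ((ContinuousLinearEquiv.refl ℝ (E d) : E d ≃L[ℝ] E d) : E d →L[ℝ] E d) Set.univ c := by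
    rw [ApproximatesLinearOn.approximatesLinearOn_iff_lipschitzOnWith]
    have : (θ - ((ContinuousLinearEquiv.refl ℝ (E d) : E d ≃L[ℝ] E d) : E d →L[ℝ] E d)) = k := by
      ext1 y
      simp [hθ]
    rw [this]
    exact hklip.lipschitzOnWith
  have hcN : Subsingleton (E d) ∨
      c < ‖((ContinuousLinearEquiv.refl ℝ (E d)).symm : E d →L[ℝ] E d)‖₊⁻¹ := by
    rcases subsingleton_or_nontrivial (E d) with h | h
    · exact Or.inl h
    · right
      have : ‖((ContinuousLinearEquiv.refl ℝ (E d)).symm : E d →L[ℝ] E d)‖₊ = 1 := by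
        ext
        exact ContinuousLinearMap.norm_id
      rw [this, inv_one]
      exact hsmall
  set Θ : E d ≃ₜ E d := happ.toHomeomorph θ hcN with hΘ
  have hΘx : ∀ y, Θ y = y + k y := fun y => rfl
  have hθd : ∀ y, HasFDerivAt Θ (ContinuousLinearMap.id ℝ (E d) + T y) y := fun y =>
    (hasFDerivAt_id y).add (hkd y)
  have hθc : ContDiff ℝ 1 Θ := contDiff_id.add hkc
  have hdet : ∀ y, 0 < (ContinuousLinearMap.id ℝ (E d) + T y).det := fun y =>
    det_pos_of_norm_lt (T y) ((hTb y).trans_lt hsmall)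
  have hΘsymm : ContDiff ℝ 1 Θ.symm := by
    refine Θ.contDiff_symm (f₀' := fun y =>
      ContinuousLinearMap.toContinuousLinearEquivOfDetNeZero _ (hdet y).ne') (fun y => ?_) hθc
    exact hθd y
  refine ⟨{ toEquiv := φ.toEquiv.trans Θ.toEquiv
            contDiff_toFun := hθc.comp φ.contDiff_toFun
            contDiff_symm := φ.contDiff_symm.comp hΘsymm
            det_pos := fun x => ?_
            disp := f
            disp_ae := ?_ }, rfl⟩
  · have h1 : HasFDerivAt (φ.toEquiv.trans Θ.toEquiv)
        ((ContinuousLinearMap.id ℝ (E d) + T (φ.toEquiv x)).comp (fderiv ℝ φ.toEquiv x)) x :=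
      (hθd _).comp x (φ.contDiff_toFun.differentiable (by norm_num) x).hasFDerivAt
    rw [h1.fderiv]
    have h2 := mul_pos (hdet (φ.toEquiv x)) (φ.det_pos x)
    rwa [ContinuousLinearMap.det, ContinuousLinearMap.det, ← LinearMap.det_comp] at h2
  · have h1 : f.toL2 = (f - φ.disp).toL2 + φ.disp.toL2 := by
      rw [← map_add, sub_add_cancel]
    rw [h1]
    filter_upwards [Lp.coeFn_add (f - φ.disp).toL2 φ.disp.toL2, hfg, φ.disp_ae] with x h2 h3 h4
    rw [h2, Pi.add_apply, h3, h4]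
    change _ = Θ (φ.toEquiv x) - x
    rw [hΘx, hk]
    simp only [Equiv.symm_apply_apply]
    abel

theorem isOpenEmbedding_disp : IsOpenEmbedding (disp : DiffGroup d s hs → H d s) :=
  ⟨⟨⟨rfl⟩, disp_injective⟩, isOpen_range_disp⟩

instance : Nonempty (DiffGroup d s hs) :=
  ⟨{ toEquiv := Equiv.refl _
     contDiff_toFun := contDiff_id
     contDiff_symm := contDiff_id
     det_pos := fun x => by
       have : fderiv ℝ (⇑(Equiv.refl (E d))) x = ContinuousLinearMap.id ℝ (E d) := fderiv_id
       rw [this]; simp [ContinuousLinearMap.det]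
     disp := 0
     disp_ae := by
       have : (H.toL2 (0 : H d s)) = 0 := map_zero _
       rw [this]
       filter_upwards [Lp.coeFn_zero (E d) 2 (volume : Measure (E d))] with x _
       simp }⟩

/-- The smooth structure of `D^s(ℝ^d)`, given by the single global chart `φ ↦ φ - id`, which is a
homeomorphism onto an open subset of `H^s(ℝ^d, ℝ^d)`. -/
instance : ChartedSpace (H d s) (DiffGroup d s hs) :=
  isOpenEmbedding_disp.singletonChartedSpace

instance : IsManifold 𝓘(ℝ, H d s) ∞ (DiffGroup d s hs) :=
  isOpenEmbedding_disp.isManifold_singleton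

/-- The Jacobian determinant `J_φ = det(dφ)`. -/
def jacobian (φ : DiffGroup d s hs) (x : E d) : ℝ := (fderiv ℝ φ.toEquiv x).det

end DiffGroup

open Classical in
/-- The composition `v ∘ ψ` of a Sobolev field with a map `ψ`, as an element of `H^s`
(and `0` if `v ∘ ψ` is not in `H^s`). -/
def H.compMap {d : ℕ} {s : ℝ} (v : H d s) (ψ : E d → E d) : H d s :=
  if h : ∃ w : H d s, w =ᵐ[volume] fun x => v (ψ x) then h.choose else 0

/-- The transpose `T^* : L² → H^{-s}` of a bounded operator `T : H^s → L²`, where `H^{-s}` is the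
dual space of `H^s` and `L²` is identified with its own dual: `(T^* u)(v) = ⟨u, T v⟩`. -/
def transpose {d : ℕ} {s : ℝ} (T : H d s →L[ℝ] L2 d) : L2 d →L[ℝ] StrongDual ℝ (H d s) :=
  ((ContinuousLinearMap.compL ℝ (H d s) (L2 d) ℝ).flip T).comp (innerSL ℝ)

theorem transpose_apply {d : ℕ} {s : ℝ} (T : H d s →L[ℝ] L2 d) (u : L2 d) (v : H d s) :
    transpose T u v = ⟪u, T v⟫ := rfl

/-- The inertia operator `A = B^* B : H^s → H^{-s}`. -/
def inertiaOperator {d : ℕ} {s : ℝ} (B : H d s →L[ℝ] L2 d) : H d s →L[ℝ] StrongDual ℝ (H d s) :=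
  (transpose B).comp B

/-- `M` is the operator of pointwise multiplication by the function `J` on `L²`. -/
def IsMultiplicationBy {d : ℕ} (M : L2 d →L[ℝ] L2 d) (J : E d → ℝ) : Prop :=
  ∀ u : L2 d, M u =ᵐ[volume] fun x => J x • u x

/-- A family `φ ↦ G_φ` of bounded bilinear forms on `T_φ D^s = H^s` (given by its flat maps
`G_φ : H^s → H^{-s}`) is a smooth Riemannian metric on `D^s(ℝ^d)`. -/
structure IsSmoothRiemannianMetric {d : ℕ} {s : ℝ} {hs : 1 + (d : ℝ) / 2 < s}
    (G : DiffGroup d s hs → H d s →L[ℝ] StrongDual ℝ (H d s)) : Prop where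
  symm : ∀ φ v w, G φ v w = G φ w v
  pos : ∀ φ v, v ≠ 0 → 0 < G φ v v
  smooth : ContMDiff 𝓘(ℝ, H d s) 𝓘(ℝ, H d s →L[ℝ] StrongDual ℝ (H d s)) ∞ G

/-- The family `φ ↦ G_φ` is strong: every flat map `G_φ : H^s → H^{-s}` is a topological linear
isomorphism. -/
def IsStrongMetric {d : ℕ} {s : ℝ} {hs : 1 + (d : ℝ) / 2 < s}
    (G : DiffGroup d s hs → H d s →L[ℝ] StrongDual ℝ (H d s)) : Prop :=
  ∀ φ, ∃ e : H d s ≃L[ℝ] StrongDual ℝ (H d s), ∀ v, e v = G φ v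

end SobolevDiff
end

/-! Put `T_φ v = B (v ∘ φ⁻¹)`, so that `G_φ(v, w) = ⟪T_φ v, T_φ w⟫` and `B_φ v = (T_φ v) ∘ φ`. The
substitution `y = φ x` turns the inner product into `⟪J_φ • B_φ v, B_φ w⟫`, which is the
factorization `B_φ^* M_{J_φ} B_φ`. Each factor is smooth in `φ`: `B_φ` by hypothesis, its transpose
because transposition is linear and bounded, and `J_φ` because it is a polynomial in the entries of
`dφ`, which by the Sobolev embedding are bounded continuous functions depending affinely on `φ -
id`. The metric is strong as soon as `T_φ` is an isomorphism onto `L²`, by the Riesz theorem.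

The hard point is that `v ∘ φ⁻¹` lies in `H^s` (`exists_comp_symm`). It is drawn from the continuity
of `φ ↦ B_φ` instead of a direct composition estimate. Take smooth compactly supported `vₙ → v` in
`H^s` and smooth `χₙ → φ` in `D^s`. Then `uₙ = vₙ ∘ χₙ⁻¹` is smooth with compact support, hence in
`H^s`, and `B uₙ = (B_{χₙ} vₙ) ∘ χₙ⁻¹` is bounded in `L²`. Since `B` is an isomorphism, `uₙ` is
bounded in `H^s`; it converges to `v ∘ φ⁻¹` in `L²`, and Fatou's lemma on the Fourier side puts the
limit in `H^s`. Applied to `φ - id`, this shows that `φ⁻¹` is again in `D^s`, whence `T_φ` is onto.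
-/

noncomputable section
namespace SobolevDiff

/-! ### Change of variables for `C¹`-diffeomorphisms -/

section ChangeOfVariables
variable {d : ℕ} (e : E d ≃ E d)

theorem map_withDensity_jacobian (he : ContDiff ℝ 1 e) :
    Measure.map e (volume.withDensity fun x => ENNReal.ofReal |(fderiv ℝ e x).det|) = volume := by
  have h := map_withDensity_abs_det_fderiv_eq_addHaar (volume : Measure (E d))
    (s := Set.univ) (f := e) (f' := fderiv ℝ e) MeasurableSet.univ.nullMeasurableSet
    (fun x _ => (he.differentiable (by norm_num) x).hasFDerivAt.hasFDerivWithinAt)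
    e.injective.injOn
  simpa [Set.image_univ, e.surjective.range_eq] using h

/-- `e` pushes `|det de| dx` forward to Lebesgue measure; pushing back by `e⁻¹` recovers the
density. -/
theorem map_symm_volume (he : ContDiff ℝ 1 e) (he' : ContDiff ℝ 1 e.symm) :
    Measure.map e.symm volume =
      volume.withDensity fun x => ENNReal.ofReal |(fderiv ℝ e x).det| := by
  conv_lhs => rw [← map_withDensity_jacobian e he]
  rw [Measure.map_map he'.continuous.measurable he.continuous.measurable]
  simp

theorem quasiMeasurePreserving_symm (he : ContDiff ℝ 1 e) (he' : ContDiff ℝ 1 e.symm) :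
    Measure.QuasiMeasurePreserving e.symm (volume : Measure (E d)) volume :=
  ⟨he'.continuous.measurable, by
    rw [map_symm_volume e he he']; exact withDensity_absolutelyContinuous _ _⟩

theorem quasiMeasurePreserving_of_contDiff (he : ContDiff ℝ 1 e) (he' : ContDiff ℝ 1 e.symm) :
    Measure.QuasiMeasurePreserving e (volume : Measure (E d)) volume :=
  quasiMeasurePreserving_symm e.symm he' he

/-- The image of Lebesgue measure under `e⁻¹` has density at most `C`. The constant involves only
the Jacobian bound, so it is uniform over families of diffeomorphisms sharing that bound. -/
theorem eLpNorm_comp_symm_le {F : Type*} [NormedAddCommGroup F]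
    (he : ContDiff ℝ 1 e) (he' : ContDiff ℝ 1 e.symm)
    {C : ℝ} (hC : ∀ x, |(fderiv ℝ e x).det| ≤ C) {u : E d → F}
    (hu : AEStronglyMeasurable u volume) :
    eLpNorm (fun y => u (e.symm y)) 2 volume ≤
      ENNReal.ofReal C ^ (1 / 2 : ℝ) * eLpNorm u 2 volume := by
  have hle : Measure.map e.symm (volume : Measure (E d)) ≤ ENNReal.ofReal C • volume := by
    rw [map_symm_volume e he he', ← withDensity_const]
    exact withDensity_mono (ae_of_all _ fun x => ENNReal.ofReal_le_ofReal (hC x))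
  have hq := quasiMeasurePreserving_symm e he he'
  calc eLpNorm (fun y => u (e.symm y)) 2 volume
      = eLpNorm u 2 (Measure.map e.symm volume) :=
        (eLpNorm_map_measure (hu.mono_ac hq.absolutelyContinuous) hq.aemeasurable).symm
    _ ≤ eLpNorm u 2 (ENNReal.ofReal C • volume) := eLpNorm_mono_measure _ hle
    _ = _ := by
      rw [eLpNorm_smul_measure_of_ne_top (by norm_num)]
      simp

theorem memLp_comp_symm {F : Type*} [NormedAddCommGroup F]
    (he : ContDiff ℝ 1 e) (he' : ContDiff ℝ 1 e.symm)
    {C : ℝ} (hC : ∀ x, |(fderiv ℝ e x).det| ≤ C) {u : E d → F}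
    (hu : MemLp u 2 volume) : MemLp (fun y => u (e.symm y)) 2 volume :=
  ⟨hu.1.comp_quasiMeasurePreserving (quasiMeasurePreserving_symm e he he'),
    (eLpNorm_comp_symm_le e he he' hC hu.1).trans_lt
      (ENNReal.mul_lt_top (ENNReal.rpow_lt_top_of_nonneg (by norm_num) ENNReal.ofReal_ne_top) hu.2)⟩

theorem integral_comp_symm (he : ContDiff ℝ 1 e) (f : E d → ℝ) :
    ∫ y, f y = ∫ x, |(fderiv ℝ e x).det| * f (e x) := by
  have h := integral_image_eq_integral_abs_det_fderiv_smul (volume : Measure (E d))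
    (s := Set.univ) (f := e) (f' := fderiv ℝ e) MeasurableSet.univ
    (fun x _ => (he.differentiable (by norm_num) x).hasFDerivAt.hasFDerivWithinAt)
    e.injective.injOn f
  simpa [Set.image_univ, e.surjective.range_eq] using h

end ChangeOfVariables

/-! ### `H^s` inside `L²`: closure under bounded limits, norm comparison -/

theorem continuous_weight (d : ℕ) (s : ℝ) : Continuous (weight d s) := by
  unfold weight
  exact Continuous.rpow_const (by fun_prop) (fun ξ => Or.inl (by positivity))

/-- A sequence that is bounded in `H^s` and converges in `L²` has its limit in `H^s`. -/
theorem mem_sobolevSubmodule_of_tendsto {d : ℕ} {s : ℝ} {u : ℕ → H d s} {f : L2 d} {K : ℝ}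
    (hK : ∀ n, ‖u n‖ ≤ K) (hu : Tendsto (fun n => (u n).toL2) atTop (𝓝 f)) :
    f ∈ sobolevSubmodule d s := by
  have hc : Continuous (fourierL2 d) :=
    (Lp.fourierTransformₗᵢ (E d) (EC d)).continuous.comp
      ((complexify d).compLpL 2 volume).continuous
  -- The Fourier transforms converge in `L²`, hence almost everywhere along a subsequence.
  have h1 := tendstoInMeasure_of_tendsto_Lp ((hc.tendsto f).comp hu)
  obtain ⟨ns, -, hns⟩ := h1.exists_seq_tendsto_ae
  refine ⟨(continuous_weight d s).aestronglyMeasurable.smul (Lp.aestronglyMeasurable _), ?_⟩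
  -- Fatou: the weighted transforms converge pointwise along the subsequence, and their `L²` norms
  -- are the `H^s` norms, at most `K`.
  refine lt_of_le_of_lt (Lp.eLpNorm_lim_le_liminf_eLpNorm (f := fun n => besselMap d s (u (ns n)))
    (fun n => Lp.aestronglyMeasurable _) _ ?_)
    (lt_of_le_of_lt (b := ENNReal.ofReal K) ?_ ENNReal.ofReal_lt_top)
  · filter_upwards [hns, ae_all_iff.2 fun n => besselMap_coe d s (u (ns n))] with ξ h2 h3
    simp only [h3]
    exact h2.const_smul _
  · refine liminf_le_of_frequently_le' (Frequently.of_forall fun n => ?_)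
    have h4 : ‖u (ns n)‖ = (eLpNorm (besselMap d s (u (ns n))) 2 volume).toReal := rfl
    rw [← ENNReal.ofReal_toReal (Lp.eLpNorm_ne_top (besselMap d s (u (ns n)))), ← h4]
    exact ENNReal.ofReal_le_ofReal (hK _)

theorem norm_complexify {d : ℕ} (x : E d) : ‖complexify d x‖ = ‖x‖ := by
  simp [EuclideanSpace.norm_eq, complexify]

theorem one_le_weight {d : ℕ} {s : ℝ} (hs : 0 ≤ s) (ξ : E d) : 1 ≤ weight d s ξ :=
  Real.one_le_rpow (by nlinarith [sq_nonneg ‖ξ‖]) (by linarith)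

/-- Plancherel, together with `weight ≥ 1` for `s ≥ 0`. -/
theorem norm_toL2_le {d : ℕ} {s : ℝ} (hs : 0 ≤ s) (f : H d s) : ‖f.toL2‖ ≤ ‖f‖ := by
  have h1 : ‖f.toL2‖ ≤ ‖(complexify d).compLpL 2 volume f.toL2‖ := by
    refine Lp.norm_le_norm_of_ae_le ?_
    filter_upwards [(complexify d).coeFn_compLpL f.toL2] with x hx
    rw [hx, norm_complexify]
  have h2 : ‖(complexify d).compLpL 2 volume f.toL2‖ = ‖fourierL2 d f.toL2‖ :=
    (Lp.norm_fourier_eq _).symm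
  refine (h1.trans_eq h2).trans ?_
  change _ ≤ ‖besselMap d s f‖
  refine Lp.norm_le_norm_of_ae_le ?_
  filter_upwards [besselMap_coe d s f] with ξ hξ
  rw [hξ, norm_smul, Real.norm_of_nonneg (weight_pos d s ξ).le]
  exact le_mul_of_one_le_left (norm_nonneg _) (one_le_weight hs ξ)

theorem H.ext_ae {d : ℕ} {s : ℝ} {f g : H d s} (h : f =ᵐ[volume] g) : f = g :=
  Subtype.ext (Lp.ext h)

theorem H.coeFn_sub {d : ℕ} {s : ℝ} (f g : H d s) :
    (f - g : H d s) =ᵐ[volume] fun x => f x - g x := by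
  rw [map_sub]; exact Lp.coeFn_sub _ _

theorem H.coeFn_add {d : ℕ} {s : ℝ} (f g : H d s) :
    (f + g : H d s) =ᵐ[volume] fun x => f x + g x := by
  rw [map_add]; exact Lp.coeFn_add _ _

theorem H.coeFn_smul {d : ℕ} {s : ℝ} (c : ℝ) (f : H d s) :
    (c • f : H d s) =ᵐ[volume] fun x => c • f x := by
  rw [map_smul]; exact Lp.coeFn_smul _ _

/-! ### Truncation of Schwartz functions -/

section Cutoff
open SchwartzMap

variable {V F : Type*} [NormedAddCommGroup V] [InnerProductSpace ℝ V] [NormedAddCommGroup F]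
  [NormedSpace ℝ F]

theorem exists_bound_iteratedFDeriv_of_hasCompactSupport {η : V → ℝ} (hη : ContDiff ℝ ∞ η)
    (hc : HasCompactSupport η) (n : ℕ) : ∃ A : ℝ, ∀ x, ‖iteratedFDeriv ℝ n η x‖ ≤ A := by
  obtain ⟨A, -, hA⟩ := (hc.toSchwartzMap hη).decay 0 n
  refine ⟨A, fun x => ?_⟩
  have h1 := hA x
  rwa [pow_zero, one_mul] at h1

/-- The truncations `η(·/R) h` of a Schwartz function `h` converge to `h`. -/
theorem seminorm_cutoff_sub_le {η : V → ℝ} (hη : ContDiff ℝ ∞ η) (hc : HasCompactSupport η)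
    (h1 : ∀ x, ‖x‖ < 1 → η x = 1) (h : 𝓢(V, F)) (k n : ℕ) :
    ∃ M : ℝ, 0 ≤ M ∧ ∀ R : ℝ, 1 ≤ R → ∀ g : 𝓢(V, F), (∀ x, g x = η (R⁻¹ • x) • h x) →
      SchwartzMap.seminorm ℝ k n (g - h) ≤ R⁻¹ * M := by
  set θ : V → ℝ := fun x => η x - 1 with hθ
  have hθc : ContDiff ℝ ∞ θ := hη.sub contDiff_const
  have hA : ∀ i, ∃ A : ℝ, ∀ x, ‖iteratedFDeriv ℝ i θ x‖ ≤ A := by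
    intro i
    obtain ⟨A, hA⟩ := exists_bound_iteratedFDeriv_of_hasCompactSupport hη hc i
    refine ⟨A + ‖(1 : ℝ)‖, fun x => ?_⟩
    have e1 : iteratedFDeriv ℝ i θ x
        = iteratedFDeriv ℝ i η x - iteratedFDeriv ℝ i (fun _ : V => (1 : ℝ)) x := by
      have := iteratedFDeriv_sub_apply (𝕜 := ℝ) (i := i) (x := x) (f := η)
        (g := fun _ : V => (1 : ℝ)) (hη.of_le (by exact_mod_cast le_top)).contDiffAt
        contDiff_const.contDiffAt
      exact this
    rw [e1]
    refine (norm_sub_le _ _).trans (add_le_add (hA x) ?_)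
    rcases Nat.eq_zero_or_pos i with rfl | hi
    · simp
    · rw [iteratedFDeriv_const_of_ne hi.ne']
      simp
  choose A hA using hA
  have hA0 : ∀ i, 0 ≤ A i := fun i => (norm_nonneg _).trans (hA i 0)
  -- The Leibniz sum. The seminorm of order `k + 1` carries one spare power of `‖x‖`, traded below
  -- for the factor `R⁻¹`.
  refine ⟨∑ i ∈ Finset.range (n + 1),
    (n.choose i : ℝ) * (A i * SchwartzMap.seminorm ℝ (k + 1) (n - i) h),
    Finset.sum_nonneg fun i _ => mul_nonneg (by positivity)
      (mul_nonneg (hA0 i) (apply_nonneg _ _)), fun R hR g hg => ?_⟩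
  have hR0 : 0 < R := by linarith
  have hgh : ⇑(g - h) = fun x => θ (R⁻¹ • x) • h x := by
    ext1 x
    rw [sub_apply, hg, hθ]
    simp [sub_smul]
  refine SchwartzMap.seminorm_le_bound ℝ k n _ (mul_nonneg (by positivity)
    (Finset.sum_nonneg fun i _ => mul_nonneg (by positivity)
      (mul_nonneg (hA0 i) (apply_nonneg _ _)))) fun x => ?_
  rcases lt_or_ge ‖x‖ R with hx | hx
  -- Inside the ball of radius `R` the cutoff is identically `1`, so the difference vanishes near
  -- `x` with all its derivatives.
  · have hev : (fun y => θ (R⁻¹ • y) • h y) =ᶠ[𝓝 x] fun _ => (0 : F) := by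
      have : ∀ᶠ y in 𝓝 x, ‖y‖ < R := continuous_norm.continuousAt.eventually_lt_const hx
      filter_upwards [this] with y hy
      have hy1 : ‖R⁻¹ • y‖ < 1 := by
        rw [norm_smul, norm_inv, Real.norm_of_nonneg hR0.le, inv_mul_lt_iff₀ hR0]
        simpa using hy
      simp [hθ, h1 _ hy1]
    rw [hgh, (Filter.EventuallyEq.iteratedFDeriv ℝ hev n).eq_of_nhds]
    have : iteratedFDeriv ℝ n (fun _ : V => (0 : F)) x = 0 := by
      have := iteratedFDeriv_fun_zero (𝕜 := ℝ) (E := V) (F := F) (n := n)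
      exact congrFun this x
    rw [this, norm_zero, mul_zero]
    exact mul_nonneg (by positivity)
      (Finset.sum_nonneg fun i _ => mul_nonneg (by positivity)
        (mul_nonneg (hA0 i) (apply_nonneg _ _)))
  -- For `‖x‖ ≥ R`: the dilation by `R⁻¹ ≤ 1` does not increase derivatives of `θ`, and `‖x‖ ^ k ≤
  -- R⁻¹ * ‖x‖ ^ (k + 1)`.
  · have hθR : ContDiff ℝ ∞ fun x : V => θ (R⁻¹ • x) := hθc.comp (contDiff_const_smul _)
    have hbd : ∀ i, ‖iteratedFDeriv ℝ i (fun x : V => θ (R⁻¹ • x)) x‖ ≤ A i := by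
      intro i
      set L : V →L[ℝ] V := R⁻¹ • ContinuousLinearMap.id ℝ V with hL
      have hL1 : ‖L‖ ≤ 1 := by
        refine ContinuousLinearMap.opNorm_le_bound _ zero_le_one fun y => ?_
        simp only [hL, _root_.smul_apply, ContinuousLinearMap.id_apply, norm_smul,
          norm_inv, Real.norm_of_nonneg hR0.le]
        gcongr
        exact inv_le_one_of_one_le₀ hR
      have e2 : (fun x : V => θ (R⁻¹ • x)) = θ ∘ L := by ext1 y; simp [hL]
      rw [e2, L.iteratedFDeriv_comp_right hθc x (i := i) (by exact_mod_cast le_top)]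
      refine (ContinuousMultilinearMap.norm_compContinuousLinearMap_le _ _).trans ?_
      calc _ ≤ A i * 1 := by
            refine mul_le_mul (hA i _) ?_ (by positivity) (hA0 i)
            exact Finset.prod_le_one (fun _ _ => norm_nonneg _) fun _ _ => hL1
        _ = A i := mul_one _
    have hdecay : ∀ i, ‖x‖ ^ k * ‖iteratedFDeriv ℝ (n - i) h x‖ ≤
        R⁻¹ * SchwartzMap.seminorm ℝ (k + 1) (n - i) h := by
      intro i
      rw [← div_eq_inv_mul, le_div_iff₀ hR0]
      refine le_trans ?_ (SchwartzMap.le_seminorm ℝ (k + 1) (n - i) h x)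
      rw [pow_succ, mul_right_comm]
      gcongr
    rw [hgh]
    calc ‖x‖ ^ k * ‖iteratedFDeriv ℝ n (fun x => θ (R⁻¹ • x) • h x) x‖
        ≤ ‖x‖ ^ k * ∑ i ∈ Finset.range (n + 1), (n.choose i : ℝ) *
            ‖iteratedFDeriv ℝ i (fun x : V => θ (R⁻¹ • x)) x‖ *
            ‖iteratedFDeriv ℝ (n - i) h x‖ := by
          gcongr
          exact norm_iteratedFDeriv_smul_le hθR (h.smooth ⊤) x (by exact_mod_cast le_top)
      _ = ∑ i ∈ Finset.range (n + 1), (n.choose i : ℝ) *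
            (‖iteratedFDeriv ℝ i (fun x : V => θ (R⁻¹ • x)) x‖ *
            (‖x‖ ^ k * ‖iteratedFDeriv ℝ (n - i) h x‖)) := by
          rw [Finset.mul_sum]
          exact Finset.sum_congr rfl fun i _ => by ring
      _ ≤ ∑ i ∈ Finset.range (n + 1), (n.choose i : ℝ) *
            (A i * (R⁻¹ * SchwartzMap.seminorm ℝ (k + 1) (n - i) h)) := by
          refine Finset.sum_le_sum fun i _ => ?_
          exact mul_le_mul_of_nonneg_left
            (mul_le_mul (hbd i) (hdecay i) (by positivity) (hA0 i)) (by positivity)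
      _ = _ := by
          rw [Finset.mul_sum]
          exact Finset.sum_congr rfl fun i _ => by ring

/-- Dilate a bump equal to `1` on the unit ball by `n + 1`; every Schwartz seminorm of the error is
`O(1 / (n + 1))`. -/
theorem exists_seq_hasCompactSupport_tendsto [FiniteDimensional ℝ V] (h : 𝓢(V, F)) :
    ∃ g : ℕ → 𝓢(V, F), (∀ n, HasCompactSupport (g n)) ∧ Tendsto g atTop (𝓝 h) := by
  set η : ContDiffBump (0 : V) := ⟨1, 2, one_pos, one_lt_two⟩ with hηd
  have hη : ContDiff ℝ ∞ η := η.contDiff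
  have hsupp : ∀ n : ℕ, HasCompactSupport fun x => η (((n : ℝ) + 1)⁻¹ • x) • h x := by
    intro n
    have h0 : ((n : ℝ) + 1)⁻¹ ≠ 0 := by positivity
    exact (η.hasCompactSupport.comp_homeomorph (Homeomorph.smulOfNeZero _ h0)).smul_right
  have hsm : ∀ n : ℕ, ContDiff ℝ ∞ fun x => η (((n : ℝ) + 1)⁻¹ • x) • h x := fun n =>
    (hη.comp (contDiff_const_smul _)).smul (h.smooth ⊤)
  refine ⟨fun n => (hsupp n).toSchwartzMap (hsm n), hsupp, ?_⟩
  rw [(schwartz_withSeminorms ℝ V F).tendsto_nhds]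
  rintro ⟨k, m⟩ ε hε
  obtain ⟨M, hM, hb⟩ := seminorm_cutoff_sub_le hη η.hasCompactSupport
    (fun x hx => η.one_of_mem_closedBall (by simpa [hηd] using hx.le)) h k m
  have hlim : Tendsto (fun n : ℕ => ((n : ℝ) + 1)⁻¹ * M) atTop (𝓝 0) := by
    simpa using (tendsto_inv_atTop_zero.comp
      (tendsto_atTop_add_const_right _ 1 tendsto_natCast_atTop_atTop)).mul_const M
  filter_upwards [hlim.eventually_lt_const hε] with n hn
  exact (hb _ (by linarith [n.cast_nonneg (α := ℝ)]) _ fun x => rfl).trans_lt hn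

end Cutoff

/-! ### Density of smooth compactly supported fields in `H^s` -/

section Density
open SchwartzMap

variable {d : ℕ} {s : ℝ}

theorem hasTemperateGrowth_weight (d : ℕ) (s : ℝ) : (weight d s).HasTemperateGrowth :=
  Function.hasTemperateGrowth_one_add_norm_sq_rpow (E d) (s / 2)

/-- Complex conjugation on `ℂ^d`. -/
def conjEC (d : ℕ) : EC d →L[ℝ] EC d :=
  LinearMap.toContinuousLinearMap
    { toFun := fun x => WithLp.toLp 2 (fun i => (starRingEnd ℂ) (x i))
      map_add' := fun x y => by ext i; simp
      map_smul' := fun c x => by ext i; simp }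

theorem conjEC_apply (x : EC d) (i : Fin d) : conjEC d x i = (starRingEnd ℂ) (x i) := rfl

theorem norm_conjEC (x : EC d) : ‖conjEC d x‖ = ‖x‖ := by
  simp [EuclideanSpace.norm_eq, conjEC_apply]

theorem conjEC_smul (c : ℂ) (x : EC d) : conjEC d (c • x) = (starRingEnd ℂ) c • conjEC d x := by
  ext i; simp [conjEC_apply]

/-- The projection of `ℂ^d` onto `ℝ^d ⊆ ℂ^d`. -/
def realProj (d : ℕ) : EC d →L[ℝ] EC d := (complexify d).comp (realPart d)

theorem realProj_eq (x : EC d) : realProj d x = (1 / 2 : ℝ) • (x + conjEC d x) := by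
  ext i
  apply Complex.ext <;> simp [realProj, complexify, realPart, conjEC_apply]
  ring

/-- Conjugating the Fourier kernel at `-ξ` gives the kernel at `ξ`. -/
theorem fourier_conjEC (f : 𝓢(E d, EC d)) (ξ : E d) :
    (𝓕 (f.postcompCLM (𝕜 := ℝ) (conjEC d)) : 𝓢(E d, EC d)) ξ = conjEC d (𝓕 f (-ξ)) := by
  rw [SchwartzMap.fourier_coe, SchwartzMap.fourier_coe, Real.fourier_eq, Real.fourier_eq]
  rw [← ContinuousLinearMap.integral_comp_comm]
  · refine integral_congr_ae (ae_of_all _ fun x => ?_)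
    simp only [SchwartzMap.postcompCLM_apply]
    rw [Circle.smul_def, Circle.smul_def, conjEC_smul, ← Circle.coe_inv_eq_conj]
    congr 2
    rw [← AddChar.map_neg_eq_inv, inner_neg_right, neg_neg]
  · exact (Real.fourierIntegral_convergent_iff (-ξ)).2 f.integrable

theorem fourier_realProj (f : 𝓢(E d, EC d)) (ξ : E d) :
    (𝓕 (f.postcompCLM (𝕜 := ℝ) (realProj d)) : 𝓢(E d, EC d)) ξ =
      (1 / 2 : ℝ) • (𝓕 f ξ + conjEC d (𝓕 f (-ξ))) := by
  have h : f.postcompCLM (𝕜 := ℝ) (realProj d) =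
      (1 / 2 : ℂ) • (f + f.postcompCLM (𝕜 := ℝ) (conjEC d)) := by
    ext x i
    simp [realProj_eq]
  rw [h, FourierTransform.fourier_smul, FourierTransform.fourier_add, ← fourier_conjEC]
  ext i
  simp

theorem toLp_postcompCLM {F G : Type*} [NormedAddCommGroup F] [NormedSpace ℝ F]
    [NormedAddCommGroup G] [NormedSpace ℝ G] (L : F →L[ℝ] G) (f : 𝓢(E d, F)) :
    L.compLpL 2 volume (f.toLp 2 volume) = (f.postcompCLM (𝕜 := ℝ) L).toLp 2 volume := by
  apply Lp.ext
  filter_upwards [L.coeFn_compLpL (f.toLp 2 volume), f.coeFn_toLp 2 volume,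
    (f.postcompCLM (𝕜 := ℝ) L).coeFn_toLp 2 volume] with x h1 h2 h3
  rw [h1, h2, h3, SchwartzMap.postcompCLM_apply]

/-- The Fourier transform of the real part, in `L²`. -/
theorem fourier_realProj_L2 (k : L2C d) :
    𝓕 ((realProj d).compLpL 2 volume k) = (1 / 2 : ℝ) • (𝓕 k + (conjEC d).compLpL 2 volume
      (Lp.compMeasurePreserving (fun x : E d => -x) (Measure.measurePreserving_neg volume)
        (𝓕 k))) := by
  have hF : Continuous (𝓕 : L2C d → L2C d) := (Lp.fourierTransformₗᵢ (E d) (EC d)).continuous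
  have hN : Continuous (Lp.compMeasurePreserving (E := EC d) (p := 2) (fun x : E d => -x)
      (Measure.measurePreserving_neg volume)) :=
    (Lp.compMeasurePreservingₗᵢ ℝ (fun x : E d => -x)
      (Measure.measurePreserving_neg volume)).continuous
  -- Both sides are continuous in `k`, so it suffices to check Schwartz fields, where
  -- `fourier_realProj` applies pointwise.
  refine DenseRange.induction_on (p := fun k : L2C d => 𝓕 ((realProj d).compLpL 2 volume k) =
      (1 / 2 : ℝ) • (𝓕 k + (conjEC d).compLpL 2 volume
      (Lp.compMeasurePreserving (fun x : E d => -x) (Measure.measurePreserving_neg volume)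
        (𝓕 k)))) (SchwartzMap.denseRange_toLpCLM (E := E d) (F := EC d) (p := 2)
          (μ := volume) ENNReal.ofNat_ne_top) k ?_ ?_
  · refine isClosed_eq (hF.comp ((realProj d).compLpL 2 volume).continuous) ?_
    exact (hF.add (((conjEC d).compLpL 2 volume).continuous.comp (hN.comp hF))).const_smul
      (1 / 2 : ℝ)
  · intro f
    change 𝓕 ((realProj d).compLpL 2 volume (f.toLp 2 volume)) =
      (1 / 2 : ℝ) • (𝓕 (f.toLp 2 volume) +
      (conjEC d).compLpL 2 volume (Lp.compMeasurePreserving (fun x : E d => -x)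
        (Measure.measurePreserving_neg volume) (𝓕 (f.toLp 2 volume))))
    rw [toLp_postcompCLM, SchwartzMap.toLp_fourier_eq, SchwartzMap.toLp_fourier_eq]
    apply Lp.ext
    set N := Lp.compMeasurePreserving (E := EC d) (p := 2) (fun x : E d => -x)
        (Measure.measurePreserving_neg volume) ((𝓕 f).toLp 2 volume) with hNd
    have hq := (Measure.measurePreserving_neg (volume : Measure (E d))).quasiMeasurePreserving
    filter_upwards [(𝓕 (f.postcompCLM (𝕜 := ℝ) (realProj d))).coeFn_toLp 2 volume,
      Lp.coeFn_smul (1 / 2 : ℝ) ((𝓕 f).toLp 2 volume + (conjEC d).compLpL 2 volume N),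
      Lp.coeFn_add ((𝓕 f).toLp 2 volume) ((conjEC d).compLpL 2 volume N),
      (conjEC d).coeFn_compLpL N, Lp.coeFn_compMeasurePreserving ((𝓕 f).toLp 2 volume)
        (Measure.measurePreserving_neg volume), (𝓕 f).coeFn_toLp 2 volume,
      hq.ae ((𝓕 f).coeFn_toLp 2 volume)] with ξ h1 h2 h3 h4 h5 h6 h7
    rw [h1, h2, Pi.smul_apply, h3, Pi.add_apply, h4, hNd, h5, Function.comp_apply, h6, h7,
      fourier_realProj]

/-- Taking real parts does not increase the complex `H^s` norm. -/
theorem eLpNorm_weight_fourier_realProj_le (k : L2C d) :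
    eLpNorm (fun ξ => weight d s ξ • (𝓕 ((realProj d).compLpL 2 volume k) : L2C d) ξ) 2 volume ≤
      eLpNorm (fun ξ => weight d s ξ • (𝓕 k : L2C d) ξ) 2 volume := by
  set u : L2C d := 𝓕 k with hu
  set a : E d → EC d := fun ξ => weight d s ξ • u ξ with ha
  have ham : AEStronglyMeasurable a volume :=
    (continuous_weight d s).aestronglyMeasurable.smul (Lp.aestronglyMeasurable u)
  have hneg := Measure.measurePreserving_neg (volume : Measure (E d))
  set N := Lp.compMeasurePreserving (E := EC d) (p := 2) (fun x : E d => -x) hneg u with hNd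
  -- The weight is even, so the weighted transform of the real part is the average of `a` and its
  -- conjugate reflection, which has the same norm as `a`.
  have h : (fun ξ => weight d s ξ • (𝓕 ((realProj d).compLpL 2 volume k) : L2C d) ξ) =ᵐ[volume]
      (1 / 2 : ℝ) • (a + fun ξ => conjEC d (a (-ξ))) := by
    rw [fourier_realProj_L2]
    filter_upwards [Lp.coeFn_smul (1 / 2 : ℝ) (u + (conjEC d).compLpL 2 volume N),
      Lp.coeFn_add u ((conjEC d).compLpL 2 volume N), (conjEC d).coeFn_compLpL N,
      Lp.coeFn_compMeasurePreserving u hneg] with ξ h2 h3 h4 h5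
    rw [h2, Pi.smul_apply, h3, Pi.add_apply, h4, hNd, h5]
    simp only [Pi.smul_apply, Pi.add_apply, ha, Function.comp_apply, map_smul]
    have hw : weight d s (-ξ) = weight d s ξ := by simp [weight]
    rw [hw, smul_comm, smul_add]
  have hc : eLpNorm (fun ξ => conjEC d (a (-ξ))) 2 volume = eLpNorm a 2 volume := by
    have h1 : eLpNorm (fun ξ => conjEC d (a (-ξ))) 2 volume
        = eLpNorm (a ∘ fun ξ => -ξ) 2 volume :=
      eLpNorm_congr_norm_ae (ae_of_all _ fun ξ => norm_conjEC _)
    rw [h1, eLpNorm_comp_measurePreserving ham hneg]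
  have hcm : AEStronglyMeasurable (fun ξ => conjEC d (a (-ξ))) volume :=
    (conjEC d).continuous.comp_aestronglyMeasurable
      (ham.comp_quasiMeasurePreserving hneg.quasiMeasurePreserving)
  rw [eLpNorm_congr_ae h, eLpNorm_const_smul]
  refine (mul_le_mul_right (eLpNorm_add_le ham hcm (by norm_num)) _).trans ?_
  rw [hc, ← two_mul, ← mul_assoc]
  refine (mul_le_mul_left (le_of_eq ?_) _).trans_eq (one_mul _)
  rw [← ofReal_norm, Real.norm_of_nonneg (by norm_num),
    ENNReal.ofReal_div_of_pos two_pos]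
  simp
  exact ENNReal.inv_mul_cancel (by norm_num) (by norm_num)

/-- The map `ψ ↦ (1 + |ξ|²)^{s/2} ψ̂` on Schwartz fields. -/
def schwartzBessel (d : ℕ) (s : ℝ) (ψ : 𝓢(E d, E d)) : 𝓢(E d, EC d) :=
  smulLeftCLM (EC d) (weight d s) (𝓕 (ψ.postcompCLM (𝕜 := ℝ) (complexify d)))

theorem continuous_schwartzBessel (d : ℕ) (s : ℝ) : Continuous (schwartzBessel d s) :=
  (ContinuousLinearMap.continuous _).comp
    ((FourierTransform.continuous_fourier (E := 𝓢(E d, EC d))).comp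
      (ContinuousLinearMap.continuous _))

theorem weight_smul_fourierL2_toLp (ψ : 𝓢(E d, E d)) :
    (fun ξ => weight d s ξ • fourierL2 d (ψ.toLp 2 volume) ξ) =ᵐ[volume] schwartzBessel d s ψ := by
  have h : fourierL2 d (ψ.toLp 2 volume) =
      (𝓕 (ψ.postcompCLM (𝕜 := ℝ) (complexify d))).toLp 2 volume := by
    change 𝓕 ((complexify d).compLpL 2 volume (ψ.toLp 2 volume)) = _
    rw [toLp_postcompCLM, SchwartzMap.toLp_fourier_eq]
  rw [h]
  filter_upwards [(𝓕 (ψ.postcompCLM (𝕜 := ℝ) (complexify d))).coeFn_toLp 2 volume] with ξ hξ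
  rw [hξ, schwartzBessel, smulLeftCLM_apply_apply (hasTemperateGrowth_weight d s)]

theorem memLp_weight_smul_fourierL2_toLp (ψ : 𝓢(E d, E d)) :
    MemLp (fun ξ => weight d s ξ • fourierL2 d (ψ.toLp 2 volume) ξ) 2 volume :=
  (memLp_congr_ae (weight_smul_fourierL2_toLp ψ)).2 ((schwartzBessel d s ψ).memLp 2 volume)

/-- A Schwartz field, as an element of `H^s`. -/
def ofSchwartz (s : ℝ) (ψ : 𝓢(E d, E d)) : H d s :=
  ⟨ψ.toLp 2 volume, memLp_weight_smul_fourierL2_toLp ψ⟩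

theorem ofSchwartz_ae (ψ : 𝓢(E d, E d)) : ofSchwartz s ψ =ᵐ[volume] ψ := ψ.coeFn_toLp 2 volume

theorem besselMap_ofSchwartz (ψ : 𝓢(E d, E d)) :
    besselMap d s (ofSchwartz s ψ) = (schwartzBessel d s ψ).toLp 2 volume := by
  apply Lp.ext
  exact (besselMap_coe d s _).trans ((weight_smul_fourierL2_toLp ψ).trans
    ((schwartzBessel d s ψ).coeFn_toLp 2 volume).symm)

theorem isometry_besselMap (d : ℕ) (s : ℝ) : Isometry (besselMap d s) :=
  AddMonoidHomClass.isometry_of_norm (besselMap d s) fun _ => rfl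

theorem continuous_ofSchwartz (d : ℕ) (s : ℝ) :
    Continuous (ofSchwartz s : 𝓢(E d, E d) → H d s) := by
  rw [(isometry_besselMap d s).isEmbedding.continuous_iff]
  have : besselMap d s ∘ ofSchwartz s = fun ψ => (schwartzBessel d s ψ).toLp 2 volume :=
    funext besselMap_ofSchwartz
  rw [this]
  exact (SchwartzMap.continuous_toLp (p := 2) (μ := volume)).comp (continuous_schwartzBessel d s)

/-- Approximate the weighted transform of `f` in `L²` by a Schwartz field, divide by the weight and
invert the Fourier transform. The result may be complex-valued; since `f` is real, passing to the
real part does not increase the error. -/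
theorem denseRange_ofSchwartz (d : ℕ) (s : ℝ) :
    DenseRange (ofSchwartz s : 𝓢(E d, E d) → H d s) := by
  rw [Metric.denseRange_iff]
  intro f ε hε
  obtain ⟨Ψ, hΨ⟩ := Metric.denseRange_iff.1 (SchwartzMap.denseRange_toLpCLM (E := E d)
    (F := EC d) (p := 2) (μ := volume) ENNReal.ofNat_ne_top) (besselMap d s f) ε hε
  set h0 : 𝓢(E d, EC d) := smulLeftCLM (EC d) (weight d (-s)) Ψ with hh0
  set h : 𝓢(E d, EC d) := 𝓕⁻ h0 with hh
  set ψ := h.postcompCLM (𝕜 := ℝ) (realPart d) with hψ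
  refine ⟨ψ, lt_of_le_of_lt ?_ hΨ⟩
  rw [dist_eq_norm, dist_eq_norm]
  set k : L2C d := (complexify d).compLpL 2 volume f.toL2 - h.toLp 2 volume with hk
  have hPk : (complexify d).compLpL 2 volume (f - ofSchwartz s ψ).toL2 =
      (realProj d).compLpL 2 volume k := by
    have e1 : (ofSchwartz s ψ).toL2 = ψ.toLp 2 volume := rfl
    rw [map_sub, map_sub, hk, map_sub, e1, toLp_postcompCLM, toLp_postcompCLM]
    congr 1
    apply Lp.ext
    filter_upwards [(complexify d).coeFn_compLpL f.toL2,
      (realProj d).coeFn_compLpL ((complexify d).compLpL 2 volume f.toL2)] with x h1 h2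
    rw [h2, h1, realProj, ContinuousLinearMap.comp_apply, realPart_complexify]
  have hFk : (fun ξ => weight d s ξ • (𝓕 k : L2C d) ξ) =ᵐ[volume]
      (besselMap d s f - Ψ.toLp 2 volume : L2C d) := by
    have e2 : 𝓕 k = fourierL2 d f.toL2 - h0.toLp 2 volume := by
      rw [hk, sub_eq_add_neg, FourierTransform.fourier_add, FourierTransform.fourier_neg,
        SchwartzMap.toLp_fourier_eq, hh, FourierTransform.fourier_fourierInv_eq]
      exact (sub_eq_add_neg _ _).symm
    rw [e2]
    filter_upwards [Lp.coeFn_sub (fourierL2 d f.toL2) (h0.toLp 2 volume),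
      Lp.coeFn_sub (besselMap d s f) (Ψ.toLp 2 volume), besselMap_coe d s f, h0.coeFn_toLp 2 volume,
      Ψ.coeFn_toLp 2 volume] with ξ h1 h2 h3 h4 h5
    rw [h1, h2, Pi.sub_apply, Pi.sub_apply, h3, h4, h5, smul_sub, hh0,
      smulLeftCLM_apply_apply (hasTemperateGrowth_weight d (-s)), smul_smul]
    have : weight d s ξ * weight d (-s) ξ = 1 := by
      have hp : 0 < 1 + ‖ξ‖ ^ 2 := by positivity
      rw [weight, weight, ← Real.rpow_add hp]
      simp [neg_div]
    rw [this, one_smul]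
  have h1 : ‖f - ofSchwartz s ψ‖ = (eLpNorm (fun ξ => weight d s ξ •
      (𝓕 ((realProj d).compLpL 2 volume k) : L2C d) ξ) 2 volume).toReal := by
    rw [← hPk]
    exact congrArg ENNReal.toReal (eLpNorm_congr_ae (besselMap_coe d s (f - ofSchwartz s ψ)))
  have h2 : ‖besselMap d s f - Ψ.toLp 2 volume‖ =
      (eLpNorm (fun ξ => weight d s ξ • (𝓕 k : L2C d) ξ) 2 volume).toReal := by
    rw [eLpNorm_congr_ae hFk]; rfl
  change _ ≤ ‖besselMap d s f - Ψ.toLp 2 volume‖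
  rw [h1, h2]
  refine ENNReal.toReal_mono ?_ (eLpNorm_weight_fourier_realProj_le k)
  rw [eLpNorm_congr_ae hFk]
  exact Lp.eLpNorm_ne_top _

/-- Smooth compactly supported fields are dense in `H^s`. -/
theorem exists_hasCompactSupport_norm_sub_lt (f : H d s) {ε : ℝ} (hε : 0 < ε) :
    ∃ h : H d s, ∃ g : E d → E d, ContDiff ℝ ∞ g ∧ HasCompactSupport g ∧ h =ᵐ[volume] g ∧
      ‖h - f‖ < ε := by
  obtain ⟨ψ, hψ⟩ := Metric.denseRange_iff.1 (denseRange_ofSchwartz d s) f (ε / 2) (by positivity)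
  obtain ⟨g, hg, hgψ⟩ := exists_seq_hasCompactSupport_tendsto ψ
  have h1 : Tendsto (fun n => ofSchwartz s (g n)) atTop (𝓝 (ofSchwartz s ψ)) :=
    ((continuous_ofSchwartz d s).tendsto ψ).comp hgψ
  rw [tendsto_iff_norm_sub_tendsto_zero] at h1
  obtain ⟨n, hn⟩ := (h1.eventually_lt_const (half_pos hε)).exists
  refine ⟨ofSchwartz s (g n), g n, (g n).smooth ⊤, hg n, ofSchwartz_ae _, ?_⟩
  rw [dist_eq_norm, norm_sub_rev] at hψ
  have h2 := norm_add_le (ofSchwartz s (g n) - ofSchwartz s ψ) (ofSchwartz s ψ - f)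
  rw [sub_add_sub_cancel] at h2
  linarith

/-- Smooth compactly supported fields belong to `H^s`. -/
theorem exists_ae_eq_of_hasCompactSupport (s : ℝ) {g : E d → E d} (hg : ContDiff ℝ ∞ g)
    (hc : HasCompactSupport g) : ∃ h : H d s, h =ᵐ[volume] g :=
  ⟨ofSchwartz s (hc.toSchwartzMap hg), ofSchwartz_ae _⟩

end Density

theorem exists_L2_comp_symm {d : ℕ} (e : E d ≃ E d) (he : ContDiff ℝ 1 e)
    (he' : ContDiff ℝ 1 e.symm) {C : ℝ} (hC : ∀ x, |(fderiv ℝ e x).det| ≤ C) (u : L2 d) :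
    ∃ w : L2 d, (w =ᵐ[volume] fun y => u (e.symm y)) ∧
      ‖w‖ ≤ (ENNReal.ofReal C ^ (1 / 2 : ℝ)).toReal * ‖u‖ := by
  have h := memLp_comp_symm e he he' hC (Lp.memLp u)
  refine ⟨h.toLp, h.coeFn_toLp, ?_⟩
  rw [Lp.norm_toLp, Lp.norm_def, ← ENNReal.toReal_mul]
  exact ENNReal.toReal_mono (ENNReal.mul_ne_top
    (ENNReal.rpow_ne_top_of_nonneg (by norm_num) ENNReal.ofReal_ne_top) (Lp.eLpNorm_ne_top u))
    (eLpNorm_comp_symm_le e he he' hC (Lp.aestronglyMeasurable u))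

/-! ### Uniform estimates and smooth approximation in `D^s` -/

namespace DiffGroup
variable {d : ℕ} {s : ℝ} {hs : 1 + (d : ℝ) / 2 < s}

theorem eq_of_disp_ae (φ : DiffGroup d s hs) {g : E d → E d} (hg : Continuous g)
    (h : φ.disp =ᵐ[volume] g) (x : E d) : φ.toEquiv x = x + g x := by
  have h1 : (fun x => φ.toEquiv x - x) = g :=
    (Continuous.ae_eq_iff_eq volume (φ.contDiff_toFun.continuous.sub continuous_id)
      hg).1 (φ.disp_ae.symm.trans h)
  rw [← h1]
  simp

theorem exists_norm_fderiv_sub_le (d : ℕ) (s : ℝ) (hs : 1 + (d : ℝ) / 2 < s) :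
    ∃ C : ℝ, 0 ≤ C ∧ ∀ (φ : DiffGroup d s hs) (x : E d),
      ‖fderiv ℝ φ.toEquiv x - ContinuousLinearMap.id ℝ (E d)‖ ≤ C * ‖φ.disp‖ := by
  obtain ⟨C, hC, hrep⟩ := exists_c1_rep d s hs
  refine ⟨C, hC, fun φ x => ?_⟩
  obtain ⟨g, hg, hfg, hgb, -⟩ := hrep φ.disp
  have h1 : HasFDerivAt φ.toEquiv (ContinuousLinearMap.id ℝ (E d) + fderiv ℝ g x) x :=
    ((hasFDerivAt_id (𝕜 := ℝ) x).add
      (hg.differentiable (by norm_num) x).hasFDerivAt).congr_of_eventuallyEq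
        (Eventually.of_forall fun z => φ.eq_of_disp_ae hg.continuous hfg z)
  rw [h1.fderiv, add_sub_cancel_left]
  exact hgb x

/-- By the Sobolev embedding all the derivatives stay in one closed ball around the identity,
compact in finite dimension, on which the determinant is bounded. -/
theorem exists_abs_jacobian_le (d : ℕ) (s : ℝ) (hs : 1 + (d : ℝ) / 2 < s) (R : ℝ) :
    ∃ K : ℝ, ∀ φ : DiffGroup d s hs, ‖φ.disp‖ ≤ R →
      ∀ x, |(fderiv ℝ φ.toEquiv x).det| ≤ K := by
  obtain ⟨C, hC, hb⟩ := exists_norm_fderiv_sub_le d s hs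
  obtain ⟨K, hK⟩ := (isCompact_closedBall (ContinuousLinearMap.id ℝ (E d))
    (C * R)).exists_bound_of_continuousOn
      (f := fun T : E d →L[ℝ] E d => T.det) ContinuousLinearMap.continuous_det.continuousOn
  refine ⟨K, fun φ hφ x => hK _ ?_⟩
  rw [Metric.mem_closedBall, dist_eq_norm]
  exact (hb φ x).trans (by gcongr)

/-- Inverse function theorem: positivity of the Jacobian makes every derivative invertible. -/
theorem contDiff_symm_of_contDiff (φ : DiffGroup d s hs) {n : WithTop ℕ∞}
    (hφ : ContDiff ℝ n φ.toEquiv) : ContDiff ℝ n φ.toEquiv.symm := by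
  let Φ : E d ≃ₜ E d :=
    { toEquiv := φ.toEquiv
      continuous_toFun := φ.contDiff_toFun.continuous
      continuous_invFun := φ.contDiff_symm.continuous }
  exact Φ.contDiff_symm (f₀' := fun y =>
      ContinuousLinearMap.toContinuousLinearEquivOfDetNeZero _ (φ.det_pos y).ne')
    (fun y => (φ.contDiff_toFun.differentiable (by norm_num) y).hasFDerivAt) hφ

/-- Smooth diffeomorphisms are dense in `D^s`. -/
theorem exists_contDiff_norm_sub_lt (φ : DiffGroup d s hs) {ε : ℝ} (hε : 0 < ε) :
    ∃ χ : DiffGroup d s hs, ContDiff ℝ ∞ χ.toEquiv.symm ∧ ‖χ.disp - φ.disp‖ < ε := by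
  -- Displacements form an open set, so a close enough smooth approximation of `φ - id` is itself
  -- the displacement of a diffeomorphism.
  obtain ⟨r, hr, hball⟩ := Metric.isOpen_iff.1 (isOpen_range_disp (hs := hs)) φ.disp ⟨φ, rfl⟩
  obtain ⟨h, g, hg, -, hhg, hlt⟩ := exists_hasCompactSupport_norm_sub_lt φ.disp (lt_min hε hr)
  obtain ⟨χ, rfl⟩ := hball (show h ∈ Metric.ball φ.disp r by
    rw [Metric.mem_ball, dist_eq_norm]; exact hlt.trans_le (min_le_right _ _))
  refine ⟨χ, χ.contDiff_symm_of_contDiff ?_, hlt.trans_le (min_le_left _ _)⟩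
  have : (χ.toEquiv : E d → E d) = fun x => x + g x :=
    funext fun x => χ.eq_of_disp_ae hg.continuous hhg x
  rw [this]
  exact contDiff_id.add hg

theorem tendsto_of_norm_disp_sub {χ : ℕ → DiffGroup d s hs} {φ : DiffGroup d s hs}
    (h : Tendsto (fun n => ‖(χ n).disp - φ.disp‖) atTop (𝓝 0)) : Tendsto χ atTop (𝓝 φ) := by
  rw [isOpenEmbedding_disp.isEmbedding.tendsto_nhds_iff]
  exact tendsto_iff_norm_sub_tendsto_zero.2 h

theorem exists_lipschitz_symm (φ : DiffGroup d s hs) :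
    ∃ K : ℝ, 0 ≤ K ∧ ∀ y z, ‖φ.toEquiv.symm y - φ.toEquiv.symm z‖ ≤ K * ‖y - z‖ := by
  obtain ⟨K, hK, hb⟩ := exists_fderiv_symm_bound φ
  exact ⟨K, hK, fun y z => Convex.norm_image_sub_le_of_norm_fderiv_le (s := Set.univ)
    (fun x _ => φ.contDiff_symm.differentiable (by norm_num) x) (fun x _ => hb x) convex_univ
    (Set.mem_univ _) (Set.mem_univ _)⟩

theorem quasiMeasurePreserving (φ : DiffGroup d s hs) :
    Measure.QuasiMeasurePreserving φ.toEquiv (volume : Measure (E d)) volume :=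
  quasiMeasurePreserving_of_contDiff _ φ.contDiff_toFun φ.contDiff_symm

theorem quasiMeasurePreserving_symm (φ : DiffGroup d s hs) :
    Measure.QuasiMeasurePreserving φ.toEquiv.symm (volume : Measure (E d)) volume :=
  SobolevDiff.quasiMeasurePreserving_symm _ φ.contDiff_toFun φ.contDiff_symm

end DiffGroup

/-! ### Stability of `H^s` under composition with `φ⁻¹` -/

section Composition
variable {d : ℕ} {s : ℝ} {hs : 1 + (d : ℝ) / 2 < s}

/-- Rules out the default value `0` of `compMap` once any representative in `H^s` is exhibited. -/
theorem H.compMap_eq {v w : H d s} {ψ : E d → E d} (hw : w =ᵐ[volume] fun x => v (ψ x)) :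
    v.compMap ψ = w := by
  have h : ∃ w : H d s, w =ᵐ[volume] fun x => v (ψ x) := ⟨w, hw⟩
  rw [H.compMap, dif_pos h]
  exact H.ext_ae (h.choose_spec.trans hw.symm)

theorem H.exists_lipschitz_rep (hs : 1 + (d : ℝ) / 2 < s) (v : H d s) :
    ∃ (g : E d → E d) (L : ℝ), (v =ᵐ[volume] g) ∧ Continuous g ∧ 0 ≤ L ∧
      ∀ x y, ‖g x - g y‖ ≤ L * ‖x - y‖ := by
  obtain ⟨C, hC, hrep⟩ := exists_c1_rep d s hs
  obtain ⟨g, hg, hvg, hb, -⟩ := hrep v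
  exact ⟨g, C * ‖v‖, hvg, hg.continuous, by positivity, fun x y =>
    Convex.norm_image_sub_le_of_norm_fderiv_le (s := Set.univ)
      (fun x _ => hg.differentiable (by norm_num) x) (fun x _ => hb x) convex_univ
      (Set.mem_univ _) (Set.mem_univ _)⟩

/-- Continuity estimate for `(v, χ) ↦ v ∘ χ⁻¹` in `L²`. -/
theorem norm_sub_le_of_ae_eq_comp {v v' u : H d s} {φ χ : DiffGroup d s hs} {f : L2 d}
    {g : E d → E d} {L K C : ℝ} (hvg : v =ᵐ[volume] g) (hL : 0 ≤ L) (hK0 : 0 ≤ K)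
    (hg : ∀ x y, ‖g x - g y‖ ≤ L * ‖x - y‖)
    (hK : ∀ y z, ‖φ.toEquiv.symm y - φ.toEquiv.symm z‖ ≤ K * ‖y - z‖)
    (hC : ∀ x, |(fderiv ℝ χ.toEquiv x).det| ≤ C)
    (hu : u =ᵐ[volume] fun y => v' (χ.toEquiv.symm y))
    (hf : f =ᵐ[volume] fun y => v (φ.toEquiv.symm y)) :
    ‖u.toL2 - f‖ ≤ (ENNReal.ofReal C ^ (1 / 2 : ℝ)).toReal * ‖v' - v‖ +
      L * K * ((ENNReal.ofReal C ^ (1 / 2 : ℝ)).toReal * ‖χ.disp - φ.disp‖) := by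
  have hs0 : 0 ≤ s := by have : (0 : ℝ) ≤ d := d.cast_nonneg; linarith
  set c := (ENNReal.ofReal C ^ (1 / 2 : ℝ)).toReal with hc
  have hc0 : 0 ≤ c := ENNReal.toReal_nonneg
  obtain ⟨w, hw, hwn⟩ := exists_L2_comp_symm χ.toEquiv χ.contDiff_toFun χ.contDiff_symm hC
    (v' - v).toL2
  obtain ⟨p, hp, hpn⟩ := exists_L2_comp_symm χ.toEquiv χ.contDiff_toFun χ.contDiff_symm hC
    (χ.disp - φ.disp).toL2
  -- What remains after removing `w = (v' - v) ∘ χ⁻¹` is `v ∘ χ⁻¹ - v ∘ φ⁻¹`. With `y = χ x`, `‖χ⁻¹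
  -- y - φ⁻¹ y‖ = ‖φ⁻¹ (φ x) - φ⁻¹ (χ x)‖ ≤ K ‖φ x - χ x‖ = K ‖p y‖`.
  have h1 : ‖u.toL2 - f - w‖ ≤ L * K * ‖p‖ := by
    refine Lp.norm_le_mul_norm_of_ae_le_mul ?_
    have hq := χ.quasiMeasurePreserving_symm
    filter_upwards [Lp.coeFn_sub (u.toL2 - f) w, Lp.coeFn_sub u.toL2 f, hu, hf, hw, hp,
      hq.ae (H.coeFn_sub v' v), hq.ae (H.coeFn_sub χ.disp φ.disp), hq.ae hvg,
      hq.ae χ.disp_ae, hq.ae φ.disp_ae, φ.quasiMeasurePreserving_symm.ae hvg] with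
      y e1 e2 e3 e4 e5 e6 e7 e8 e9 e10 e11 e12
    rw [e1, Pi.sub_apply, e2, Pi.sub_apply, e3, e4, e5, e6, e7, e8, e9, e10, e11, e12]
    have e13 : v' (χ.toEquiv.symm y) - g (φ.toEquiv.symm y) -
        (v' (χ.toEquiv.symm y) - g (χ.toEquiv.symm y)) =
        g (χ.toEquiv.symm y) - g (φ.toEquiv.symm y) := by abel
    rw [e13, sub_sub_sub_cancel_right, Equiv.apply_symm_apply, mul_assoc]
    refine (hg _ _).trans (mul_le_mul_of_nonneg_left ?_ hL)
    have h2 := hK (φ.toEquiv (χ.toEquiv.symm y)) y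
    rwa [Equiv.symm_apply_apply, norm_sub_rev _ y] at h2
  calc ‖u.toL2 - f‖ = ‖w + (u.toL2 - f - w)‖ := by rw [add_sub_cancel]
    _ ≤ ‖w‖ + ‖u.toL2 - f - w‖ := norm_add_le _ _
    _ ≤ c * ‖v' - v‖ + L * K * (c * ‖χ.disp - φ.disp‖) := by
        refine add_le_add (hwn.trans ?_) (h1.trans ?_)
        · gcongr
          exact norm_toL2_le hs0 _
        · gcongr
          exact hpn.trans (by gcongr; exact norm_toL2_le hs0 _)

/-- If `φ ↦ B_φ` is continuous, then composition with `φ⁻¹` preserves `H^s`. The formula for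
`B_φ v` is only needed for smooth `φ` and smooth compactly supported `v`, for which `v ∘ φ⁻¹` is
known to belong to `H^s`; the general case follows by density. -/
theorem exists_comp_symm (B : H d s ≃L[ℝ] L2 d) {Bc : DiffGroup d s hs → (H d s →L[ℝ] L2 d)}
    (hBc : ∀ (φ : DiffGroup d s hs) (v : H d s),
      Bc φ v =ᵐ[volume] fun x => B (v.compMap φ.toEquiv.symm) (φ.toEquiv x))
    (hcont : Continuous Bc) (φ : DiffGroup d s hs) (v : H d s) :
    ∃ w : H d s, w =ᵐ[volume] fun x => v (φ.toEquiv.symm x) := by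
  have hpos : ∀ n : ℕ, 0 < 1 / ((n : ℝ) + 1) := fun n => Nat.one_div_pos_of_nat
  choose v' g' hg' hc' hvg' hv' using fun n : ℕ =>
    exists_hasCompactSupport_norm_sub_lt v (hpos n)
  choose χ hχ hχφ using fun n : ℕ => φ.exists_contDiff_norm_sub_lt (hpos n)
  have hv0 : Tendsto (fun n => ‖v' n - v‖) atTop (𝓝 0) :=
    squeeze_zero (fun _ => norm_nonneg _) (fun n => (hv' n).le)
      tendsto_one_div_add_atTop_nhds_zero_nat
  have hχ0 : Tendsto (fun n => ‖(χ n).disp - φ.disp‖) atTop (𝓝 0) :=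
    squeeze_zero (fun _ => norm_nonneg _) (fun n => (hχφ n).le)
      tendsto_one_div_add_atTop_nhds_zero_nat
  -- the compositions `v' n ∘ (χ n)⁻¹` are smooth with compact support
  have hex : ∀ n, ∃ u : H d s, u =ᵐ[volume] fun y => v' n ((χ n).toEquiv.symm y) := by
    intro n
    let Φ : E d ≃ₜ E d :=
      { toEquiv := (χ n).toEquiv.symm
        continuous_toFun := (χ n).contDiff_symm.continuous
        continuous_invFun := (χ n).contDiff_toFun.continuous }
    obtain ⟨u, hu⟩ := exists_ae_eq_of_hasCompactSupport s ((hg' n).comp (hχ n))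
      ((hc' n).comp_homeomorph Φ)
    refine ⟨u, hu.trans ?_⟩
    filter_upwards [(χ n).quasiMeasurePreserving_symm.ae (hvg' n)] with y hy
    rw [hy]
    rfl
  choose u hu using hex
  -- a uniform bound for the Jacobians
  have hdisp : ∀ n, ‖(χ n).disp‖ ≤ ‖φ.disp‖ + 1 := by
    intro n
    have h1 := norm_add_le ((χ n).disp - φ.disp) φ.disp
    rw [sub_add_cancel] at h1
    have h2 : 1 / ((n : ℝ) + 1) ≤ 1 := by
      rw [div_le_one (by positivity)]
      linarith [n.cast_nonneg (α := ℝ)]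
    linarith [hχφ n]
  obtain ⟨C, hC⟩ := DiffGroup.exists_abs_jacobian_le d s hs (‖φ.disp‖ + 1)
  set c := (ENNReal.ofReal C ^ (1 / 2 : ℝ)).toReal with hc
  have hc0 : 0 ≤ c := ENNReal.toReal_nonneg
  -- boundedness in `H^s`
  obtain ⟨K₁, hK₁⟩ := (((hcont.tendsto φ).comp
    (DiffGroup.tendsto_of_norm_disp_sub hχ0)).norm).bddAbove_range
  obtain ⟨K₂, hK₂⟩ := (tendsto_iff_norm_sub_tendsto_zero.2 hv0).norm.bddAbove_range
  have hbound : ∀ n, ‖u n‖ ≤ ‖(B.symm : L2 d →L[ℝ] H d s)‖ * (c * (K₁ * K₂)) := by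
    intro n
    obtain ⟨w, hw, hwn⟩ := exists_L2_comp_symm (χ n).toEquiv (χ n).contDiff_toFun
      (χ n).contDiff_symm (hC _ (hdisp n)) (Bc (χ n) (v' n))
    -- Since `u n` is in `H^s`, `compMap` has its true value and `B (u n) = (B_{χₙ} vₙ) ∘ χₙ⁻¹`.
    have hBu : B (u n) = w := by
      apply Lp.ext
      have h1 := hBc (χ n) (v' n)
      rw [H.compMap_eq (hu n)] at h1
      filter_upwards [hw, (χ n).quasiMeasurePreserving_symm.ae h1] with y h2 h3
      rw [h2, h3, Equiv.apply_symm_apply]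
    have hk1 : ‖Bc (χ n)‖ ≤ K₁ := hK₁ ⟨n, rfl⟩
    have hk2 : ‖v' n‖ ≤ K₂ := hK₂ ⟨n, rfl⟩
    calc ‖u n‖ = ‖(B.symm : L2 d →L[ℝ] H d s) (B (u n))‖ := by simp
      _ ≤ ‖(B.symm : L2 d →L[ℝ] H d s)‖ * ‖B (u n)‖ := ContinuousLinearMap.le_opNorm _ _
      _ ≤ _ := by
        rw [hBu]
        refine mul_le_mul_of_nonneg_left (hwn.trans (mul_le_mul_of_nonneg_left ?_ hc0))
          (norm_nonneg _)
        exact (ContinuousLinearMap.le_opNorm _ _).trans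
          (mul_le_mul hk1 hk2 (norm_nonneg _) ((norm_nonneg _).trans hk1))
  -- convergence in `L²`
  obtain ⟨g, L, hvg, -, hL, hg⟩ := v.exists_lipschitz_rep hs
  obtain ⟨K, hK, hφK⟩ := φ.exists_lipschitz_symm
  obtain ⟨f, hf, -⟩ := exists_L2_comp_symm φ.toEquiv φ.contDiff_toFun
    φ.contDiff_symm (hC φ (by linarith)) v.toL2
  have hlim : Tendsto (fun n => (u n).toL2) atTop (𝓝 f) := by
    rw [tendsto_iff_norm_sub_tendsto_zero]
    refine squeeze_zero (fun _ => norm_nonneg _) (fun n => norm_sub_le_of_ae_eq_comp hvg hL hK hg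
      hφK (hC _ (hdisp n)) (hu n) hf) ?_
    have h := (hv0.const_mul c).add ((hχ0.const_mul c).const_mul (L * K))
    simp only [mul_zero, add_zero] at h
    exact h
  exact ⟨⟨f, mem_sobolevSubmodule_of_tendsto hbound hlim⟩, hf⟩

end Composition

/-! ### Multiplication operators and smoothness of the Jacobian -/

section Multiplication
open BoundedContinuousFunction
variable {d : ℕ} {s : ℝ} {hs : 1 + (d : ℝ) / 2 < s}

theorem memLp_smul_boundedContinuous (f : E d →ᵇ ℝ) (u : L2 d) :
    MemLp (fun x => f x • u x) 2 volume :=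
  (Lp.memLp u).of_le_mul (c := ‖f‖)
    (f.continuous.aestronglyMeasurable.smul (Lp.aestronglyMeasurable u))
    (ae_of_all _ fun x => by
      rw [norm_smul]; exact mul_le_mul_of_nonneg_right (f.norm_coe_le_norm x) (norm_nonneg _))

/-- Multiplication of `L²` fields by bounded continuous functions. -/
def mulL2 (d : ℕ) : (E d →ᵇ ℝ) →L[ℝ] L2 d →L[ℝ] L2 d :=
  LinearMap.mkContinuous₂ (LinearMap.mk₂ ℝ
    (fun f u => (memLp_smul_boundedContinuous f u).toLp)
    (fun f g u => by
      rw [← MemLp.toLp_add]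
      exact MemLp.toLp_congr _ _ (ae_of_all _ fun x => add_smul _ _ _))
    (fun c f u => by
      rw [← MemLp.toLp_const_smul]
      exact MemLp.toLp_congr _ _ (ae_of_all _ fun x => mul_smul c (f x) (u x)))
    (fun f u v => by
      rw [← MemLp.toLp_add]
      refine MemLp.toLp_congr _ _ ?_
      filter_upwards [Lp.coeFn_add u v] with x hx
      rw [hx, Pi.add_apply, smul_add, Pi.add_apply])
    (fun c f u => by
      rw [← MemLp.toLp_const_smul]
      refine MemLp.toLp_congr _ _ ?_
      filter_upwards [Lp.coeFn_smul c u] with x hx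
      rw [hx, Pi.smul_apply, smul_comm, Pi.smul_apply])) 1 (fun f u => by
    rw [one_mul]
    refine Lp.norm_le_mul_norm_of_ae_le_mul ?_
    filter_upwards [(memLp_smul_boundedContinuous f u).coeFn_toLp] with x hx
    rw [LinearMap.mk₂_apply, hx, norm_smul]
    exact mul_le_mul_of_nonneg_right (f.norm_coe_le_norm x) (norm_nonneg _))

theorem isMultiplicationBy_mulL2 (f : E d →ᵇ ℝ) : IsMultiplicationBy (mulL2 d f) f :=
  fun u => (memLp_smul_boundedContinuous f u).coeFn_toLp

/-- The derivative of Sobolev fields, as bounded continuous functions. -/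
theorem exists_derivCLM (d : ℕ) (s : ℝ) (hs : 1 + (d : ℝ) / 2 < s) :
    ∃ D : H d s →L[ℝ] (E d →ᵇ (E d →L[ℝ] E d)), ∀ (f : H d s) (g : E d → E d),
      ContDiff ℝ 1 g → (f =ᵐ[volume] g) → ∀ x, D f x = fderiv ℝ g x := by
  obtain ⟨C, hC, hrep⟩ := exists_c1_rep d s hs
  choose g hg hfg hgb hg0 using hrep
  -- Continuous representatives are unique, so the chosen ones depend linearly on `f`.
  have huniq : ∀ (f : H d s) (k : E d → E d), Continuous k → (f =ᵐ[volume] k) → g f = k :=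
    fun f k hk hfk => (Continuous.ae_eq_iff_eq volume (hg f).continuous hk).1
      ((hfg f).symm.trans hfk)
  have hd : ∀ f x, DifferentiableAt ℝ (g f) x := fun f x => (hg f).differentiable (by norm_num) x
  have hadd : ∀ f₁ f₂, g (f₁ + f₂) = g f₁ + g f₂ := fun f₁ f₂ =>
    huniq _ _ ((hg f₁).continuous.add (hg f₂).continuous) (by
      filter_upwards [H.coeFn_add f₁ f₂, hfg f₁, hfg f₂] with x h1 h2 h3
      rw [h1, h2, h3, Pi.add_apply])
  have hsmul : ∀ (c : ℝ) f, g (c • f) = c • g f := fun c f =>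
    huniq _ _ ((hg f).continuous.const_smul c) (by
      filter_upwards [H.coeFn_smul c f, hfg f] with x h1 h2
      rw [h1, h2, Pi.smul_apply])
  let D₀ : H d s →ₗ[ℝ] (E d →ᵇ (E d →L[ℝ] E d)) :=
    { toFun := fun f => BoundedContinuousFunction.ofNormedAddCommGroup (fderiv ℝ (g f))
        ((hg f).continuous_fderiv (by norm_num)) (C * ‖f‖) (hgb f)
      map_add' := fun f₁ f₂ => by
        ext1 x
        change fderiv ℝ (g (f₁ + f₂)) x = fderiv ℝ (g f₁) x + fderiv ℝ (g f₂) x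
        rw [hadd, fderiv_add (hd _ _) (hd _ _)]
      map_smul' := fun c f => by
        ext1 x
        change fderiv ℝ (g (c • f)) x = c • fderiv ℝ (g f) x
        rw [hsmul, fderiv_const_smul (hd _ _)] }
  let D₁ : H d s →L[ℝ] (E d →ᵇ (E d →L[ℝ] E d)) :=
    { D₀ with
      cont := AddMonoidHomClass.continuous_of_bound D₀ C fun f =>
        BoundedContinuousFunction.norm_ofNormedAddCommGroup_le _ (by positivity) (hgb f) }
  refine ⟨D₁, fun f k hk hfk x => ?_⟩
  change fderiv ℝ (g f) x = _
  rw [huniq f k hk.continuous hfk]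

theorem det_eq_matrix_det (T : E d →L[ℝ] E d) :
    T.det = Matrix.det (Matrix.of fun i j : Fin d => T (EuclideanSpace.single j 1) i) := by
  rw [ContinuousLinearMap.det, ← LinearMap.det_toMatrix (EuclideanSpace.basisFun (Fin d) ℝ).toBasis]
  congr 1

/-- The Jacobian determinant depends smoothly on the displacement. -/
theorem exists_contDiff_jacobian (d : ℕ) (s : ℝ) (hs : 1 + (d : ℝ) / 2 < s) :
    ∃ J : H d s → (E d →ᵇ ℝ), ContDiff ℝ ∞ J ∧
      ∀ (φ : DiffGroup d s hs) (x : E d), J φ.disp x = φ.jacobian x := by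
  obtain ⟨D, hD⟩ := exists_derivCLM d s hs
  let ℓ : Fin d → Fin d → (E d →L[ℝ] E d) →L[ℝ] ℝ := fun i j =>
    (EuclideanSpace.proj i : E d →L[ℝ] ℝ).comp
      (ContinuousLinearMap.apply ℝ (E d) (EuclideanSpace.single j (1 : ℝ)))
  -- The matrix of `id + df`, over the commutative ring of bounded continuous functions: its entries
  -- are affine and continuous in `f`, so its determinant is smooth in `f`.
  let A : H d s → Matrix (Fin d) (Fin d) (E d →ᵇ ℝ) := fun f =>
    Matrix.of fun i j => const (E d) (ℓ i j (ContinuousLinearMap.id ℝ (E d))) +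
      (ℓ i j).compLeftContinuousBounded (E d) (D f)
  refine ⟨fun f => (A f).det, ?_, fun φ x => ?_⟩
  · simp only [Matrix.det_apply']
    refine ContDiff.sum fun σ _ => contDiff_const.mul (contDiff_prod fun i _ => ?_)
    exact contDiff_const.add (ContinuousLinearMap.contDiff
      (((ℓ (σ i) i).compLeftContinuousBounded (E d)).comp D))
  · obtain ⟨C, hC, hrep⟩ := exists_c1_rep d s hs
    obtain ⟨g, hg, hfg, -, -⟩ := hrep φ.disp
    have h1 : HasFDerivAt φ.toEquiv (ContinuousLinearMap.id ℝ (E d) + fderiv ℝ g x) x :=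
      ((hasFDerivAt_id (𝕜 := ℝ) x).add
        (hg.differentiable (by norm_num) x).hasFDerivAt).congr_of_eventuallyEq
          (Eventually.of_forall fun z => φ.eq_of_disp_ae hg.continuous hfg z)
    -- Evaluation at `x` is a ring homomorphism, so it commutes with the determinant.
    let ev : (E d →ᵇ ℝ) →+* ℝ :=
      { toFun := fun f => f x
        map_one' := rfl
        map_mul' := fun _ _ => rfl
        map_zero' := rfl
        map_add' := fun _ _ => rfl }
    change ev (A φ.disp).det = _
    rw [RingHom.map_det, DiffGroup.jacobian, h1.fderiv, det_eq_matrix_det]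
    congr 1
    ext i j
    change ℓ i j (ContinuousLinearMap.id ℝ (E d)) + ℓ i j (D φ.disp x) = _
    rw [hD _ g hg hfg]
    rfl

end Multiplication

namespace DiffGroup
variable {d : ℕ} {s : ℝ} {hs : 1 + (d : ℝ) / 2 < s}

theorem contMDiff_disp :
    ContMDiff 𝓘(ℝ, H d s) 𝓘(ℝ, H d s) ∞ (disp : DiffGroup d s hs → H d s) :=
  contMDiff_isOpenEmbedding isOpenEmbedding_disp

end DiffGroup

theorem contDiff_transpose {d : ℕ} {s : ℝ} :
    ContDiff ℝ ∞ (transpose : (H d s →L[ℝ] L2 d) → L2 d →L[ℝ] StrongDual ℝ (H d s)) :=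
  (ContinuousLinearMap.contDiff _).clm_comp contDiff_const

/-! ### Inverses in `D^s` -/

section Inverse
variable {d : ℕ} {s : ℝ} {hs : 1 + (d : ℝ) / 2 < s}

/-- By the chain rule the Jacobians of `φ⁻¹` and `φ` at corresponding points multiply to `1`. -/
theorem DiffGroup.det_fderiv_symm_pos (φ : DiffGroup d s hs) (y : E d) :
    0 < (fderiv ℝ φ.toEquiv.symm y).det := by
  obtain ⟨x, rfl⟩ := φ.toEquiv.surjective y
  have h1 := (φ.contDiff_symm.differentiable (by norm_num) (φ.toEquiv x)).hasFDerivAt.comp x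
    (φ.contDiff_toFun.differentiable (by norm_num) x).hasFDerivAt
  have h2 : (φ.toEquiv.symm ∘ φ.toEquiv : E d → E d) = id := by ext1 x; simp
  rw [h2] at h1
  have h3 := congrArg ContinuousLinearMap.det (h1.unique (hasFDerivAt_id x))
  have h4 : (fderiv ℝ φ.toEquiv.symm (φ.toEquiv x)).det * (fderiv ℝ φ.toEquiv x).det = 1 := by
    rw [ContinuousLinearMap.det, ContinuousLinearMap.det, ← LinearMap.det_comp]
    refine h3.trans ?_
    simp [ContinuousLinearMap.det]
  exact pos_of_mul_pos_left (by rw [h4]; exact one_pos) (φ.det_pos x).le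

/-- If composition with `φ⁻¹` preserves `H^s`, then `φ⁻¹` belongs to `D^s`. -/
theorem DiffGroup.exists_inverse (φ : DiffGroup d s hs)
    (h : ∀ v : H d s, ∃ w : H d s, w =ᵐ[volume] fun x => v (φ.toEquiv.symm x)) :
    ∃ ψ : DiffGroup d s hs, ψ.toEquiv = φ.toEquiv.symm := by
  -- `φ⁻¹ - id = -(φ - id) ∘ φ⁻¹`.
  obtain ⟨w, hw⟩ := h (-φ.disp)
  refine ⟨{ toEquiv := φ.toEquiv.symm
            contDiff_toFun := φ.contDiff_symm
            contDiff_symm := φ.contDiff_toFun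
            det_pos := φ.det_fderiv_symm_pos
            disp := w
            disp_ae := ?_ }, rfl⟩
  have hneg : (-φ.disp : H d s) =ᵐ[volume] fun x => -φ.disp x := by
    rw [map_neg]; exact Lp.coeFn_neg _
  have hq := φ.quasiMeasurePreserving_symm
  filter_upwards [hw, hq.ae hneg, hq.ae φ.disp_ae] with y h1 h2 h3
  rw [h1, h2, h3, Equiv.apply_symm_apply, neg_sub]

end Inverse

/-! ### The isomorphism `T_φ` and strong metrics -/

section Metric
variable {d : ℕ} {s : ℝ} {hs : 1 + (d : ℝ) / 2 < s}

/-- The operator `v ↦ B (v ∘ φ⁻¹)` is a topological linear isomorphism from `H^s` to `L²`. -/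
theorem exists_equiv_comp_symm (B : H d s ≃L[ℝ] L2 d)
    {Bc : DiffGroup d s hs → (H d s →L[ℝ] L2 d)}
    (hBc : ∀ (φ : DiffGroup d s hs) (v : H d s),
      Bc φ v =ᵐ[volume] fun x => B (v.compMap φ.toEquiv.symm) (φ.toEquiv x))
    (hcont : Continuous Bc) (φ : DiffGroup d s hs) :
    ∃ T : H d s ≃L[ℝ] L2 d, ∀ v, T v = B (v.compMap φ.toEquiv.symm) := by
  have hcomp := exists_comp_symm B hBc hcont
  have hspec : ∀ v : H d s, v.compMap φ.toEquiv.symm =ᵐ[volume] fun x => v (φ.toEquiv.symm x) := by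
    intro v
    obtain ⟨w, hw⟩ := hcomp φ v
    rwa [H.compMap_eq hw]
  have hq := φ.quasiMeasurePreserving_symm
  have hC := DiffGroup.exists_abs_jacobian_le d s hs ‖φ.disp‖
  obtain ⟨C, hC⟩ := hC
  let T₀ : H d s →ₗ[ℝ] L2 d :=
    { toFun := fun v => B (v.compMap φ.toEquiv.symm)
      map_add' := fun v w => by
        rw [← map_add]
        congr 1
        refine H.compMap_eq ?_
        filter_upwards [H.coeFn_add (v.compMap φ.toEquiv.symm) (w.compMap φ.toEquiv.symm),
          hspec v, hspec w, hq.ae (H.coeFn_add v w)] with x h1 h2 h3 h4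
        rw [h1, h2, h3, h4]
      map_smul' := fun c v => by
        rw [RingHom.id_apply, ← map_smul]
        congr 1
        refine H.compMap_eq ?_
        filter_upwards [H.coeFn_smul c (v.compMap φ.toEquiv.symm),
          hspec v, hq.ae (H.coeFn_smul c v)] with x h1 h2 h3
        rw [h1, h2, h3] }
  -- Boundedness comes from `T_φ v = (B_φ v) ∘ φ⁻¹` and the Jacobian bound.
  let T₁ : H d s →L[ℝ] L2 d :=
    T₀.mkContinuous ((ENNReal.ofReal C ^ (1 / 2 : ℝ)).toReal * ‖Bc φ‖) fun v => by
      obtain ⟨w, hw, hwn⟩ := exists_L2_comp_symm φ.toEquiv φ.contDiff_toFun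
        φ.contDiff_symm (hC φ le_rfl) (Bc φ v)
      have h : T₀ v = w := by
        apply Lp.ext
        filter_upwards [hw, hq.ae (hBc φ v)] with y h2 h3
        rw [h2, h3, Equiv.apply_symm_apply]
        rfl
      rw [h, mul_assoc]
      exact hwn.trans (mul_le_mul_of_nonneg_left (ContinuousLinearMap.le_opNorm _ _)
        ENNReal.toReal_nonneg)
  have hT₁ : ∀ v, T₁ v = B (v.compMap φ.toEquiv.symm) := fun _ => rfl
  have hinj : ∀ v, T₁ v = 0 → v = 0 := by
    intro v hv
    have h1 : v.compMap φ.toEquiv.symm = 0 := by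
      rw [hT₁] at hv
      exact B.map_eq_zero_iff.1 hv
    have h0 : ((0 : H d s) : E d → E d) =ᵐ[volume] fun _ => 0 := by
      rw [map_zero]; exact Lp.coeFn_zero _ _ _
    refine H.ext_ae ?_
    have h2 := hspec v
    rw [h1] at h2
    filter_upwards [h0, φ.quasiMeasurePreserving.ae h0, φ.quasiMeasurePreserving.ae h2] with
      x h3 h4 h5
    rw [h3, ← h4, h5, Equiv.symm_apply_apply]
  -- Since `φ⁻¹` is in `D^s`, composition with `φ` also preserves `H^s`; the preimage of `b` is
  -- `(B⁻¹ b) ∘ φ`.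
  have hsurj : Function.Surjective T₁ := by
    intro b
    obtain ⟨ψ, hψ⟩ := φ.exists_inverse (hcomp φ)
    obtain ⟨w, hw⟩ := hcomp ψ (B.symm b)
    rw [hψ, Equiv.symm_symm] at hw
    refine ⟨w, ?_⟩
    have h1 : w.compMap φ.toEquiv.symm = B.symm b := by
      refine H.compMap_eq ?_
      filter_upwards [hq.ae hw] with y hy
      rw [hy, Equiv.apply_symm_apply]
    rw [hT₁, h1, B.apply_symm_apply]
  -- Completeness, transported from `L²` by `B`, lets the open mapping theorem invert `T₁`.
  have : CompleteSpace (H d s) :=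
    (completeSpace_congr (e := B.toEquiv) B.isUniformEmbedding).2 inferInstance
  exact ⟨ContinuousLinearEquiv.ofBijective T₁ (LinearMap.ker_eq_bot'.2 hinj)
    (LinearMap.range_eq_top.2 hsurj), fun v => rfl⟩

/-- Substitute `y = φ x`; preservation of orientation removes the absolute value from the Jacobian.
-/
theorem inner_eq_inner_mul_jacobian (φ : DiffGroup d s hs) {M : L2 d →L[ℝ] L2 d}
    (hM : IsMultiplicationBy M φ.jacobian) {a b a' b' : L2 d}
    (ha : a' =ᵐ[volume] fun x => a (φ.toEquiv x)) (hb : b' =ᵐ[volume] fun x => b (φ.toEquiv x)) :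
    ⟪a, b⟫ = ⟪M a', b'⟫ := by
  rw [L2.inner_def, L2.inner_def, integral_comp_symm φ.toEquiv φ.contDiff_toFun]
  refine integral_congr_ae ?_
  filter_upwards [hM a', ha, hb] with x h1 h2 h3
  rw [h1, h2, h3, inner_smul_left, abs_of_pos (φ.det_pos x)]
  rfl

/-- A bilinear form `(v, w) ↦ ⟨T v, T w⟩` with `T : H^s → L²` an isomorphism is strong. -/
theorem exists_equiv_dual (T : H d s ≃L[ℝ] L2 d) (G : H d s →L[ℝ] StrongDual ℝ (H d s))
    (hG : ∀ v w, G v w = ⟪T v, T w⟫) :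
    ∃ e : H d s ≃L[ℝ] StrongDual ℝ (H d s), ∀ v, e v = G v := by
  have : CompleteSpace (H d s) :=
    (completeSpace_congr (e := T.toEquiv) T.isUniformEmbedding).2 inferInstance
  have hinj : ∀ v, G v = 0 → v = 0 := by
    intro v hv
    have h := hG v v
    rw [hv] at h
    exact T.map_eq_zero_iff.1 (inner_self_eq_zero.1 h.symm)
  have hsurj : Function.Surjective G := by
    intro ℓ
    -- Riesz representation of `ℓ ∘ T⁻¹` on `L²`.
    obtain ⟨z, hz⟩ := (InnerProductSpace.toDual ℝ (L2 d)).surjective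
      (ℓ.comp (T.symm : L2 d →L[ℝ] H d s))
    refine ⟨T.symm z, ?_⟩
    ext w
    rw [hG, T.apply_symm_apply, ← InnerProductSpace.toDual_apply_apply, hz]
    simp
  exact ⟨ContinuousLinearEquiv.ofBijective G (LinearMap.ker_eq_bot'.2 hinj)
    (LinearMap.range_eq_top.2 hsurj), fun v => rfl⟩

end Metric

end SobolevDiff
end

/-! ### The main theorem -/

open SobolevDiff in
theorem mainTheorem10 (d : ℕ) (s : ℝ) (hs : 1 + (d : ℝ) / 2 < s)
    (B : H d s ≃L[ℝ] L2 d)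
    (Bc : DiffGroup d s hs → (H d s →L[ℝ] L2 d))
    (hBc : ∀ (φ : DiffGroup d s hs) (v : H d s),
      Bc φ v =ᵐ[volume] fun x => B (v.compMap φ.toEquiv.symm) (φ.toEquiv x))
    (hsmooth : ContMDiff 𝓘(ℝ, H d s) 𝓘(ℝ, H d s →L[ℝ] L2 d) ∞ Bc) :
    (∀ (φ : DiffGroup d s hs) (v : H d s),
      v.compMap φ.toEquiv.symm =ᵐ[volume] fun x => v (φ.toEquiv.symm x)) ∧
    ∃ G : DiffGroup d s hs → H d s →L[ℝ] StrongDual ℝ (H d s),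
      (∀ (φ : DiffGroup d s hs) (v₁ v₂ : H d s), G φ v₁ v₂ =
        inertiaOperator (B : H d s →L[ℝ] L2 d)
          (v₁.compMap φ.toEquiv.symm) (v₂.compMap φ.toEquiv.symm)) ∧
      IsSmoothRiemannianMetric G ∧
      IsStrongMetric G ∧
      ∀ φ : DiffGroup d s hs, ∃ M : L2 d →L[ℝ] L2 d,
        IsMultiplicationBy M φ.jacobian ∧
        G φ = (transpose (Bc φ)).comp (M.comp (Bc φ)) := by
  have hcont := hsmooth.continuous
  refine ⟨fun φ v => ?_, ?_⟩
  · obtain ⟨w, hw⟩ := exists_comp_symm B hBc hcont φ v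
    rwa [H.compMap_eq hw]
  choose T hT using exists_equiv_comp_symm B hBc hcont
  obtain ⟨J, hJ, hJφ⟩ := exists_contDiff_jacobian d s hs
  have hM : ∀ φ : DiffGroup d s hs, IsMultiplicationBy (mulL2 d (J φ.disp)) φ.jacobian := by
    intro φ
    rw [show φ.jacobian = J φ.disp from funext fun x => (hJφ φ x).symm]
    exact isMultiplicationBy_mulL2 _
  -- The factorized form serves as definition, since it shows smoothness; symmetry, positivity and
  -- strength are read off `hGT`.
  set G : DiffGroup d s hs → H d s →L[ℝ] StrongDual ℝ (H d s) := fun φ =>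
    (transpose (Bc φ)).comp ((mulL2 d (J φ.disp)).comp (Bc φ)) with hG
  have hGT : ∀ φ v w, G φ v w = ⟪T φ v, T φ w⟫ := by
    intro φ v w
    rw [hT, hT]
    exact (inner_eq_inner_mul_jacobian φ (hM φ) (hBc φ v) (hBc φ w)).symm
  refine ⟨G, fun φ v₁ v₂ => ?_, ⟨fun φ v w => ?_, fun φ v hv => ?_, ?_⟩, fun φ => ?_,
    fun φ => ⟨_, hM φ, rfl⟩⟩
  · rw [hGT, hT, hT]
    rfl
  · rw [hGT, hGT, real_inner_comm]
  · rw [hGT]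
    exact real_inner_self_pos.2 fun h => hv ((T φ).map_eq_zero_iff.1 h)
  · refine (contDiff_transpose.contMDiff.comp hsmooth).clm_comp (ContMDiff.clm_comp ?_ hsmooth)
    exact ((mulL2 d).contDiff.comp hJ).contMDiff.comp DiffGroup.contMDiff_disp
  · exact exists_equiv_dual (T φ) (G φ) (hGT φ)
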